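/- **Theorem (MLE with growing $J$).** Let $F_t$ ($t\ge 1$) be i.i.d. $N(0,\sigma^2)$ and $\epsilon_{it}$ ($i,t\ge 1$) i.i.d. $N(0,1)$, the factor and the shocks being independent. Consider a sequence of samples with $J\to\infty$ donors and $T_0\to\infty$ pre-treatment periods, and real loadings $\lambda_1,\dots,\lambda_{J+1}$ which may change with the sample and are uniformly bounded. The outcomes are $y_{it}=\lambda_iF_t+\epsilon_{it}$, unit $1$ is the treated unit, $\boldsymbol y_{Jt}=(y_{2t},\dots,y_{J+1,t})'$, and the target weights $\tilde{\boldsymbol w}\in\mathbb R^J$ are $$\tilde w_j=\frac{\sigma^2\lambda_1\lambda_j}{1+\sigma^2\sum_{k=2}^{J+1}\lambda_k^2},\qquad j=2,\dots,J+1 .$$ Let $\epsilon_{Jt}=y_{1t}-\boldsymbol y_{Jt}'\tilde{\boldsymbol w}$ be the prediction error, $\tilde\Sigma=\mathbb E[\epsilon_{Jt}^2]$ (the conditional variance of $y_{1t}$ given $\boldsymbol y_{Jt}$, the same for all $t$) and $\tilde{\boldsymbol\theta}=(\tilde{\boldsymbol w},\tilde\Sigma)$. Let $\Theta\subset\mathbb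 R^J\times(0,\infty)$ be a compact parameter space (depending on the sample size, not on the data) with $\tilde{\boldsymbol\theta}\in\Theta$, and let the (measurable) estimator $\hat{\boldsymbol\theta}_{MLE}=(\hat{\boldsymbol w}_{MLE},\hat\Sigma)$ maximize over $\boldsymbol\theta=(\boldsymbol w,\Sigma)\in\Theta$, almost surely, the pseudo log-likelihood $$l_{T_0}(\boldsymbol\theta)=-\tfrac12\log(2\pi\Sigma)-\frac1{T_0}\sum_{t=1}^{T_0}\frac1{2\Sigma}\bigl(y_{1t}-\boldsymbol y_{Jt}'\boldsymbol w\bigr)^2 .$$ Assume: 1. the matrices $D_{T_0}=\frac1{T_0}\sum_{t\le T_0}\boldsymbol y_{Jt}\boldsymbol y_{Jt}'$ satisfy, almost surely, $0<\liminf\sigma_{\min}(D_{T_0})\le\limsup\sigma_{\max}(D_{T_0})<\infty$, where $\sigma_{\min},\sigma_{\max}$ denote the smallest and the largest eigenvalue; 2. $\max_{t\le T_0}\|\boldsymbol y_{Jt}\|_2^2=O_p(J)$; 3. $\sup_{\|\boldsymbol\beta\|_2=\|\boldsymbol\gamma\|_2=1}\sum_{t\le T_0}|\boldsymbol y_{Jt}'\boldsymbol\beta|^2|\boldsymbol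 y_{Jt}'\boldsymbol\gamma|^2=O_p(T_0)$. If $J(\log J)^3=o(T_0)$, then $$\|\hat{\boldsymbol w}_{MLE}-\tilde{\boldsymbol w}\|_2^2=O_p(J/T_0).$$ If $J^2\log J=o(T_0)$ and $\tilde{\boldsymbol\theta}$ is an interior point of $\Theta$ uniformly in the sample size (for some $r>0$ independent of the sample size, $\Theta$ contains every $(\boldsymbol w,\Sigma)$ with $\|\boldsymbol w-\tilde{\boldsymbol w}\|_2<r$ and $|\Sigma-\tilde\Sigma|<r$), then, for every deterministic sequence of nonzero vectors $\boldsymbol\alpha\in\mathbb R^J$, $$\frac{\sqrt{T_0}\,\boldsymbol\alpha'(\hat{\boldsymbol w}_{MLE}-\tilde{\boldsymbol w})}{\sigma_\alpha}\ \overset{d}{\to}\ N(0,1),\qquad \sigma_\alpha^2=\mathbb E[\epsilon_{Jt}^2]\;\boldsymbol\alpha'D_{T_0}^{-1}\boldsymbol\alpha .$$ -/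

import Mathlib

open Filter MeasureTheory ProbabilityTheory Asymptotics
open scoped Topology NNReal ENNReal Matrix

noncomputable section

namespace SynthControl

variable {Ω : Type*}

/-- Stochastic boundedness `X n = O_p (a n)` as `n → ∞`: for every `δ > 0` there is `M` such that
`P (|X n| > M * a n) ≤ δ` for all large `n`. -/
def IsBigOp [MeasurableSpace Ω] (μ : Measure Ω) (X : ℕ → Ω → ℝ) (a : ℕ → ℝ) : Prop :=
  ∀ δ : ℝ≥0∞, 0 < δ → ∃ M : ℝ, ∀ᶠ n in atTop, μ {ω | M * a n < |X n ω|} ≤ δ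

/-- The assumptions on the scalar factor `F t` and on the idiosyncratic shocks `ε i t` (unit `i`,
period `t`): `F t` is i.i.d. `N(0, σ²)`, `ε i t` is i.i.d. `N(0, 1)`, and the factor is independent
of the shocks. -/
structure FactorAssumptions [MeasurableSpace Ω] (μ : Measure Ω) (σ : ℝ≥0) (F : ℕ → Ω → ℝ) (ε : ℕ → ℕ → Ω → ℝ) :
    Prop where
  law_F : ∀ t, HasLaw (F t) (gaussianReal 0 (σ ^ 2)) μ
  law_ε : ∀ i t, HasLaw (ε i t) (gaussianReal 0 1) μ
  indep : iIndepFun (Sum.elim F (fun p : ℕ × ℕ => ε p.1 p.2)) μ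

/-- The untreated outcome of unit `i` in period `t`, for the loadings `lam`. Unit `0` is the
treated unit, the donors are the units `1, …, J`; the pre-treatment periods are `0, …, T - 1`. -/
def outcome (lam : ℕ → ℝ) (F : ℕ → Ω → ℝ) (ε : ℕ → ℕ → Ω → ℝ) (i t : ℕ) (ω : Ω) : ℝ :=
  lam i * F t ω + ε i t ω

/-- The vector of the outcomes of the `J` donors in period `t`. -/
def donors (J : ℕ) (lam : ℕ → ℝ) (F : ℕ → Ω → ℝ) (ε : ℕ → ℕ → Ω → ℝ) (t : ℕ) (ω : Ω) :
    EuclideanSpace ℝ (Fin J) :=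
  WithLp.toLp 2 fun j => outcome lam F ε (j + 1) t ω

/-- The target weights `w_j = σ² λ₁ λ_j / (1 + σ² ∑ λ_j²)` (`λ₁` being the loading of the treated
unit and the sum running over the donors). -/
def targetWeights (J : ℕ) (σ : ℝ≥0) (lam : ℕ → ℝ) : EuclideanSpace ℝ (Fin J) :=
  WithLp.toLp 2 fun j =>
    (σ : ℝ) ^ 2 * lam 0 * lam (j + 1) / (1 + ∑ k : Fin J, lam (k + 1) ^ 2 * (σ : ℝ) ^ 2)

/-- The error of the linear prediction of the treated unit by the donors with the target weights. -/
def predError (J : ℕ) (σ : ℝ≥0) (lam : ℕ → ℝ) (F : ℕ → Ω → ℝ) (ε : ℕ → ℕ → Ω → ℝ) (t : ℕ)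
    (ω : Ω) : ℝ :=
  outcome lam F ε 0 t ω - inner ℝ (donors J lam F ε t ω) (targetWeights J σ lam)

/-- The second moment of the prediction error (the same in every period; taken in period `0`).
It is the variance of the treated outcome given the donor outcomes. -/
def errVar [MeasurableSpace Ω] (μ : Measure Ω) (J : ℕ) (σ : ℝ≥0) (lam : ℕ → ℝ) (F : ℕ → Ω → ℝ)
    (ε : ℕ → ℕ → Ω → ℝ) : ℝ :=
  ∫ ω, predError J σ lam F ε 0 ω ^ 2 ∂μ

/-- The target parameter: target weights and conditional variance. -/
def targetParam [MeasurableSpace Ω] (μ : Measure Ω) (J : ℕ) (σ : ℝ≥0) (lam : ℕ → ℝ) (F : ℕ → Ω → ℝ)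
    (ε : ℕ → ℕ → Ω → ℝ) : EuclideanSpace ℝ (Fin J) × ℝ :=
  (targetWeights J σ lam, errVar μ J σ lam F ε)

/-- The pseudo log-likelihood at `θ = (w, Σ)` from the periods `0, …, T - 1`. -/
def logLik (J T : ℕ) (lam : ℕ → ℝ) (F : ℕ → Ω → ℝ) (ε : ℕ → ℕ → Ω → ℝ) (ω : Ω)
    (θ : EuclideanSpace ℝ (Fin J) × ℝ) : ℝ :=
  -(1 / 2) * Real.log (2 * Real.pi * θ.2)
    - (1 / (T : ℝ)) * ∑ t ∈ Finset.range T,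
        1 / (2 * θ.2) * (outcome lam F ε 0 t ω - inner ℝ (donors J lam F ε t ω) θ.1) ^ 2

/-- The design Gram matrix `D = (1/T) ∑ y_t y_t'`. -/
def gram (J T : ℕ) (lam : ℕ → ℝ) (F : ℕ → Ω → ℝ) (ε : ℕ → ℕ → Ω → ℝ) (ω : Ω) :
    Matrix (Fin J) (Fin J) ℝ :=
  (1 / (T : ℝ)) • ∑ t ∈ Finset.range T,
    Matrix.vecMulVec (donors J lam F ε t ω).ofLp (donors J lam F ε t ω).ofLp

theorem gram_isHermitian (J T : ℕ) (lam : ℕ → ℝ) (F : ℕ → Ω → ℝ) (ε : ℕ → ℕ → Ω → ℝ) (ω : Ω) :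
    (gram J T lam F ε ω).IsHermitian := by
  ext i j
  simp [gram, Matrix.sum_apply, Matrix.vecMulVec_apply, mul_comm]

/-- The smallest eigenvalue of the Gram matrix, in `[0, ∞]`. -/
def gramMin (J T : ℕ) (lam : ℕ → ℝ) (F : ℕ → Ω → ℝ) (ε : ℕ → ℕ → Ω → ℝ) (ω : Ω) : ℝ≥0∞ :=
  ⨅ i, ENNReal.ofReal ((gram_isHermitian J T lam F ε ω).eigenvalues i)

/-- The largest eigenvalue of the Gram matrix, in `[0, ∞]`. -/
def gramMax (J T : ℕ) (lam : ℕ → ℝ) (F : ℕ → Ω → ℝ) (ε : ℕ → ℕ → Ω → ℝ) (ω : Ω) : ℝ≥0∞ :=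
  ⨆ i, ENNReal.ofReal ((gram_isHermitian J T lam F ε ω).eigenvalues i)

/-- `max_{t < T} ‖y_t‖²`. -/
def maxSqNorm (J T : ℕ) (lam : ℕ → ℝ) (F : ℕ → Ω → ℝ) (ε : ℕ → ℕ → Ω → ℝ) (ω : Ω) : ℝ :=
  ⨆ t : Fin T, ‖donors J lam F ε t ω‖ ^ 2

/-- `sup_{β, γ} ∑_{t < T} |y_t'β|² |y_t'γ|²` over unit vectors `β, γ` (the supremum of a continuous
function on a compact set). -/
def fourthMomentSup (J T : ℕ) (lam : ℕ → ℝ) (F : ℕ → Ω → ℝ) (ε : ℕ → ℕ → Ω → ℝ) (ω : Ω) : ℝ :=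
  ⨆ p : Metric.sphere (0 : EuclideanSpace ℝ (Fin J)) 1 ×
      Metric.sphere (0 : EuclideanSpace ℝ (Fin J)) 1,
    ∑ t ∈ Finset.range T,
      |inner ℝ (donors J lam F ε t ω) p.1.1| ^ 2 * |inner ℝ (donors J lam F ε t ω) p.2.1| ^ 2

/-- `σ_α`, where `σ_α² = E[e²] α' D⁻¹ α` and `e` is the prediction error. -/
def sigmaAlpha [MeasurableSpace Ω] (μ : Measure Ω) (J T : ℕ) (σ : ℝ≥0) (lam : ℕ → ℝ) (F : ℕ → Ω → ℝ)
    (ε : ℕ → ℕ → Ω → ℝ) (α : EuclideanSpace ℝ (Fin J)) (ω : Ω) : ℝ :=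
  Real.sqrt (errVar μ J σ lam F ε * (α.ofLp ⬝ᵥ ((gram J T lam F ε ω)⁻¹ *ᵥ α.ofLp)))

end SynthControl

end

/-!
The prediction errors `eₜ` and the donor outcomes are jointly Gaussian and, by the choice of the
target weights `w̃`, uncorrelated. Hence the errors are i.i.d. `N(0, v)`, where
`v = errVar = condVar`, and independent of all donor outcomes of all periods
(`FactorAssumptions.isWhiteNoise_predError`, `FactorAssumptions.indepFun_predError_donors`).
Conditionally on the donors, the model is a linear regression with a fixed design and Gaussian
noise.

With `δ = w - w̃`, the mean squared residual at `w` is `s - 2 ⟨δ, b⟩ + ⟨δ, D δ⟩`, where `s` is the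
mean of the `eₜ²` (`targetRisk`), `b = T⁻¹ ∑ₜ eₜ yₜ` (`score`) and `D` is the Gram matrix
(`risk_eq`). Outside an event of small probability the eigenvalues of `D` are at least some
`c > 0`, `‖b‖² = O(J / T)` by orthogonality of the errors, and `s - v = O(T^{-1/2})` by Chebyshev's
inequality (`FactorAssumptions.exists_eventually_good`).

*Rate.* Comparing the likelihood at the maximizer with that at the target and profiling out the
variance gives `⟨δ, D δ⟩ - 2 ⟨δ, b⟩ = O((s / v - 1)²) = O(1 / T)`, so that
`‖δ‖² = O(‖b‖² + 1 / T) = O(J / T)` (`norm_sq_le_of_isMaxOn`).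

*Normality.* As `J / T → 0`, the least squares estimator `w̃ + D⁻¹ b` together with its mean squared
residual lies in the given ball around the target with probability tending to one. It is the unique
unconstrained maximizer, so it is the maximum likelihood estimator
(`eq_designSolve_of_isMaxOn`). The studentized least squares estimator is
`∑ₜ uₜ eₜ / √v`, where the coefficients `uₜ` depend on the donors alone and satisfy `∑ₜ uₜ² = 1`
(`student_eq_sum`); conditionally on the donors, hence also unconditionally, it is exactly `N(0, 1)`
(`IsWhiteNoise.hasLaw_sum_of_indepFun`). No central limit theorem is involved.
-/

namespace SynthControl

/-! ### Gaussian white noise -/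

section WhiteNoise

variable {Ω : Type*} [MeasurableSpace Ω] {μ : Measure Ω}

/-- A centred Gaussian sequence whose terms are uncorrelated (hence independent) and have
variance `v`. -/
structure IsWhiteNoise (e : ℕ → Ω → ℝ) (v : ℝ) (μ : Measure Ω) : Prop where
  gaussian : IsGaussianProcess e μ
  mean : ∀ t, ∫ ω, e t ω ∂μ = 0
  cov : ∀ s t, cov[e s, e t; μ] = if s = t then v else 0

namespace IsWhiteNoise

variable {e : ℕ → Ω → ℝ} {v : ℝ}

theorem memLp (h : IsWhiteNoise e v μ) (t : ℕ) : MemLp (e t) 2 μ :=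
  (h.gaussian.hasGaussianLaw_eval t).memLp_two

theorem variance (h : IsWhiteNoise e v μ) (t : ℕ) : Var[e t; μ] = v := by
  rw [← covariance_self (h.memLp t).aemeasurable, h.cov, if_pos rfl]

theorem nonneg (h : IsWhiteNoise e v μ) : 0 ≤ v :=
  h.variance 0 ▸ variance_nonneg _ _

theorem integral_mul (h : IsWhiteNoise e v μ) (s t : ℕ) :
    ∫ ω, e s ω * e t ω ∂μ = if s = t then v else 0 := by
  have := h.gaussian.isProbabilityMeasure
  have h1 := covariance_eq_sub (h.memLp s) (h.memLp t)
  rw [h.cov, h.mean, h.mean] at h1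
  simpa using h1.symm

theorem hasLaw_sum (h : IsWhiteNoise e v μ) (I : Finset ℕ) (u : ℕ → ℝ) :
    HasLaw (fun ω => ∑ t ∈ I, u t * e t ω) (gaussianReal 0 (v * ∑ t ∈ I, u t ^ 2).toNNReal) μ := by
  have := h.gaussian.isProbabilityMeasure
  have hG := (h.gaussian.smul u).hasGaussianLaw_fun_sum (I := I)
  simp only [smul_eq_mul] at hG
  refine ⟨hG.aemeasurable, ?_⟩
  have hm : ∫ ω, ∑ t ∈ I, u t * e t ω ∂μ = 0 := by
    rw [integral_finsetSum _ fun t _ => ((h.memLp t).integrable one_le_two).const_mul _]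
    simp [integral_const_mul, h.mean]
  have hL : ∀ t ∈ I, MemLp (fun ω => u t * e t ω) 2 μ := fun t _ => (h.memLp t).const_mul _
  have hv : Var[fun ω => ∑ t ∈ I, u t * e t ω; μ] = v * ∑ t ∈ I, u t ^ 2 := by
    rw [← covariance_self hG.aemeasurable, covariance_fun_sum_fun_sum' hL hL, Finset.mul_sum]
    refine Finset.sum_congr rfl fun t ht => ?_
    rw [Finset.sum_eq_single_of_mem t ht]
    · rw [covariance_const_mul_left, covariance_const_mul_right, h.cov, if_pos rfl]; ring
    · intro s _ hs
      rw [covariance_const_mul_left, covariance_const_mul_right, h.cov, if_neg hs.symm]; ring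
  rw [hG.map_eq_gaussianReal, hm, hv]

theorem hasLaw (h : IsWhiteNoise e v μ) (t : ℕ) :
    HasLaw (e t) (gaussianReal 0 v.toNNReal) μ := by
  simpa using h.hasLaw_sum {t} 1

/-- Mixing over random coefficients of norm one that are independent of the noise does not change
the Gaussian law: conditionally on the coefficients the sum has law `N(0, v)`. -/
theorem hasLaw_sum_of_indepFun (h : IsWhiteNoise e v μ) {𝓨 : Type*} [MeasurableSpace 𝓨]
    {Y : Ω → 𝓨} (hY : AEMeasurable Y μ) (hind : IndepFun (fun ω t => e t ω) Y μ) (I : Finset ℕ)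
    {u : 𝓨 → ℕ → ℝ} (hu : Measurable u) (hu1 : ∀ y, ∑ t ∈ I, u y t ^ 2 = 1) :
    HasLaw (fun ω => ∑ t ∈ I, u (Y ω) t * e t ω) (gaussianReal 0 v.toNNReal) μ := by
  have := h.gaussian.isProbabilityMeasure
  have he : AEMeasurable (fun ω t => e t ω) μ :=
    aemeasurable_pi_lambda _ fun t => h.gaussian.aemeasurable t
  have hg : Measurable fun p : (ℕ → ℝ) × 𝓨 => ∑ t ∈ I, u p.2 t * p.1 t := by fun_prop
  refine ⟨hg.comp_aemeasurable (he.prodMk hY), ?_⟩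
  have : IsProbabilityMeasure (μ.map Y) := Measure.isProbabilityMeasure_map hY
  have : IsProbabilityMeasure (μ.map fun ω t => e t ω) := Measure.isProbabilityMeasure_map he
  have hcomp : (fun ω => ∑ t ∈ I, u (Y ω) t * e t ω) =
      (fun p : (ℕ → ℝ) × 𝓨 => ∑ t ∈ I, u p.2 t * p.1 t) ∘ fun ω => (fun t => e t ω, Y ω) := rfl
  rw [hcomp, ← AEMeasurable.map_map_of_aemeasurable hg.aemeasurable (he.prodMk hY),
    (indepFun_iff_map_prod_eq_prod_map_map he hY).1 hind]
  ext s hs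
  rw [Measure.map_apply hg hs, Measure.prod_apply_symm (hg hs)]
  have hfib : ∀ y, (μ.map fun ω t => e t ω)
      ((fun x => (x, y)) ⁻¹' ((fun p : (ℕ → ℝ) × 𝓨 => ∑ t ∈ I, u p.2 t * p.1 t) ⁻¹' s)) =
      gaussianReal 0 v.toNNReal s := by
    intro y
    have hl := h.hasLaw_sum I (u y)
    rw [hu1, mul_one] at hl
    rw [← hl.map_eq, Measure.map_apply_of_aemeasurable hl.aemeasurable hs,
      Measure.map_apply_of_aemeasurable he]
    · rfl
    · exact (hg.comp measurable_prodMk_right) hs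
  simp_rw [hfib]
  simp

/-- Multiplying the noise by an independent sequence `x` keeps the terms orthogonal. -/
theorem integral_sum_mul_sq (h : IsWhiteNoise e v μ) {x : ℕ → Ω → ℝ}
    (hx : ∀ t, MemLp (x t) 2 μ)
    (hind : IndepFun (fun ω t => e t ω) (fun ω t => x t ω) μ) (I : Finset ℕ) :
    Integrable (fun ω => (∑ t ∈ I, e t ω * x t ω) ^ 2) μ ∧
      ∫ ω, (∑ t ∈ I, e t ω * x t ω) ^ 2 ∂μ = v * ∑ t ∈ I, ∫ ω, x t ω ^ 2 ∂μ := by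
  have hexp : ∀ ω, (∑ t ∈ I, e t ω * x t ω) ^ 2 =
      ∑ s ∈ I, ∑ t ∈ I, (e s ω * e t ω) * (x s ω * x t ω) := by
    intro ω
    rw [sq, Finset.sum_mul_sum]
    exact Finset.sum_congr rfl fun s _ => Finset.sum_congr rfl fun t _ => by ring
  have hi : ∀ s t, IndepFun (fun ω => e s ω * e t ω) (fun ω => x s ω * x t ω) μ := fun s t =>
    hind.comp (φ := fun f : ℕ → ℝ => f s * f t) (ψ := fun f : ℕ → ℝ => f s * f t)
      (by fun_prop) (by fun_prop)
  have he2 : ∀ s t, Integrable (fun ω => e s ω * e t ω) μ :=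
    fun s t => (h.memLp s).integrable_mul (h.memLp t)
  have hx2 : ∀ s t, Integrable (fun ω => x s ω * x t ω) μ :=
    fun s t => (hx s).integrable_mul (hx t)
  have hint : ∀ s t, Integrable (fun ω => (e s ω * e t ω) * (x s ω * x t ω)) μ :=
    fun s t => (hi s t).integrable_mul (he2 s t) (hx2 s t)
  simp_rw [hexp]
  refine ⟨integrable_finsetSum _ fun s _ => integrable_finsetSum _ fun t _ => hint s t, ?_⟩
  rw [integral_finsetSum _ fun s _ => integrable_finsetSum _ fun t _ => hint s t, Finset.mul_sum]
  refine Finset.sum_congr rfl fun s hs => ?_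
  rw [integral_finsetSum _ fun t _ => hint s t]
  have hterm : ∀ t, ∫ ω, (e s ω * e t ω) * (x s ω * x t ω) ∂μ =
      (if s = t then v else 0) * ∫ ω, x s ω * x t ω ∂μ := by
    intro t
    rw [← h.integral_mul s t]
    exact (hi s t).integral_fun_mul_eq_mul_integral (he2 s t).aestronglyMeasurable
      (hx2 s t).aestronglyMeasurable
  simp_rw [hterm, ite_mul, zero_mul]
  rw [Finset.sum_ite_eq]
  simp [hs, sq]

/-- The second moment of the white noise is estimated by its empirical version at rate `T^{-1/2}`,
with a constant that scales with `v`. -/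
theorem measure_abs_sum_sq_sub_ge (h : IsWhiteNoise e v μ) {T : ℕ} (hT : 0 < T) {c : ℝ}
    (hc : 0 < c) :
    μ {ω | c ≤ |(1 / (T : ℝ)) * ∑ t ∈ Finset.range T, e t ω ^ 2 - v|} ≤
      ENNReal.ofReal (v ^ 2 * Var[fun x => x ^ 2; gaussianReal 0 1] / T / c ^ 2) := by
  have := h.gaussian.isProbabilityMeasure
  have hv0 := h.nonneg
  have hT' : (T : ℝ) ≠ 0 := by positivity
  -- The law of `eₜ` is that of `√v` times a standard normal variable, so `Var[eₜ²]` is `v²` times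
  -- a constant.
  have hlaw : ∀ t, HasLaw (e t) ((gaussianReal 0 1).map (Real.sqrt v * ·)) μ := by
    intro t
    convert h.hasLaw t using 1
    rw [gaussianReal_map_const_mul]
    congr 1
    · simp
    · ext; simp [Real.sq_sqrt hv0, hv0]
  have hq : MemLp (fun x : ℝ => x ^ 2) 2 (gaussianReal 0 1) := by
    have h4 := (memLp_id_gaussianReal' (μ := 0) (v := 1) 4 (by simp)).norm_rpow_div 2
    have : (4 : ℝ≥0∞) / 2 = 2 := by
      rw [show (4 : ℝ≥0∞) = 2 * 2 by norm_num, ENNReal.mul_div_cancel_right (by simp) (by simp)]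
    rw [this] at h4
    simpa using h4
  have hcomp : ∀ x : ℝ, (Real.sqrt v * x) ^ 2 = v * x ^ 2 := fun x => by
    rw [mul_pow, Real.sq_sqrt hv0]
  have hmap : MemLp (fun x : ℝ => x ^ 2) 2 ((gaussianReal 0 1).map (Real.sqrt v * ·)) := by
    rw [memLp_map_measure_iff (by fun_prop) (by fun_prop)]
    simpa [Function.comp_def, hcomp] using hq.const_mul v
  have hmem : ∀ t, MemLp (fun ω => e t ω ^ 2) 2 μ := by
    intro t
    have := (hlaw t).map_eq ▸ hmap
    exact (memLp_map_measure_iff (by fun_prop) (hlaw t).aemeasurable).1 this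
  have hvar : ∀ t, Var[fun ω => e t ω ^ 2; μ] = v ^ 2 * Var[fun x => x ^ 2; gaussianReal 0 1] := by
    intro t
    have h1 := variance_map (X := fun x : ℝ => x ^ 2) (Y := e t) (μ := μ) (by fun_prop)
      (hlaw t).aemeasurable
    have h2 := variance_map (X := fun x : ℝ => x ^ 2) (Y := fun x => Real.sqrt v * x)
      (μ := gaussianReal 0 1) (by fun_prop) (by fun_prop)
    rw [(hlaw t).map_eq, h2] at h1
    simp only [Function.comp_def, hcomp] at h1
    rw [← h1, variance_const_mul]
  have hindep : ∀ s t, s ≠ t → IndepFun (fun ω => e s ω ^ 2) (fun ω => e t ω ^ 2) μ := by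
    intro s t hst
    have h1 : IndepFun (e s) (e t) μ :=
      (h.gaussian.hasGaussianLaw_prodMk (s := s) (t := t)).indepFun_of_covariance_eq_zero
        (by rw [h.cov, if_neg hst])
    exact h1.comp (φ := fun x => x ^ 2) (ψ := fun x => x ^ 2) (by fun_prop) (by fun_prop)
  set S : Ω → ℝ := fun ω => (1 / (T : ℝ)) * ∑ t ∈ Finset.range T, e t ω ^ 2 with hS
  have hSmem : MemLp S 2 μ := (memLp_finsetSum _ fun t _ => hmem t).const_mul _
  have hSmean : ∫ ω, S ω ∂μ = v := by
    rw [hS, integral_const_mul, integral_finsetSum _ fun t _ => (hmem t).integrable one_le_two]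
    have : ∀ t, ∫ ω, e t ω ^ 2 ∂μ = v := fun t => by
      simpa [sq] using h.integral_mul t t
    simp [this]
    field_simp
  have hSvar : Var[S; μ] = v ^ 2 * Var[fun x => x ^ 2; gaussianReal 0 1] / T := by
    have h1 := IndepFun.variance_sum (μ := μ) (X := fun t ω => e t ω ^ 2) (s := Finset.range T)
      (fun t _ => hmem t) (fun s _ t _ hst => hindep s t hst)
    rw [hS, variance_const_mul]
    have h2 : (fun ω => ∑ t ∈ Finset.range T, e t ω ^ 2) =
        ∑ t ∈ Finset.range T, fun ω => e t ω ^ 2 := by ext; simp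
    rw [h2, h1]
    simp [hvar]
    field_simp
  have := meas_ge_le_variance_div_sq hSmem hc
  rwa [hSmean, hSvar] at this

end IsWhiteNoise

end WhiteNoise

/-! ### The one-factor model: the prediction error is noise independent of the donors -/

theorem predError_eq {Ω : Type*} (σ : ℝ≥0) (F : ℕ → Ω → ℝ) (ε : ℕ → ℕ → Ω → ℝ) (lam : ℕ → ℝ)
    (J t : ℕ) : predError J σ lam F ε t = fun ω => outcome lam F ε 0 t ω -
    ∑ k : Fin J, targetWeights J σ lam k * outcome lam F ε (k + 1) t ω := by
  ext ω
  simp [predError, donors, PiLp.inner_apply]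

/-- The variance of the treated outcome given the donor outcomes, in closed form; it equals `errVar`
(`FactorAssumptions.errVar_eq`). -/
noncomputable def condVar (J : ℕ) (σ : ℝ≥0) (lam : ℕ → ℝ) : ℝ :=
  1 + lam 0 ^ 2 * (σ : ℝ) ^ 2 / (1 + ∑ k : Fin J, lam (k + 1) ^ 2 * (σ : ℝ) ^ 2)

theorem sum_targetWeights_mul (J : ℕ) (σ : ℝ≥0) (lam : ℕ → ℝ) :
    ∑ k : Fin J, targetWeights J σ lam k * lam (k + 1) * (σ : ℝ) ^ 2 =
      (σ : ℝ) ^ 2 * lam 0 * (1 - 1 / (1 + ∑ k : Fin J, lam (k + 1) ^ 2 * (σ : ℝ) ^ 2)) := by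
  have hV : 0 < 1 + ∑ k : Fin J, lam (k + 1) ^ 2 * (σ : ℝ) ^ 2 := by positivity
  have : ∀ k : Fin J, targetWeights J σ lam k * lam (k + 1) * (σ : ℝ) ^ 2 =
      (σ : ℝ) ^ 2 * lam 0 / (1 + ∑ k : Fin J, lam (k + 1) ^ 2 * (σ : ℝ) ^ 2) *
        (lam (k + 1) ^ 2 * (σ : ℝ) ^ 2) := fun k => by
    simp only [targetWeights]; ring
  rw [Finset.sum_congr rfl fun k _ => this k, ← Finset.mul_sum]
  field_simp
  ring

theorem one_le_condVar (J : ℕ) (σ : ℝ≥0) (lam : ℕ → ℝ) : 1 ≤ condVar J σ lam := by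
  have : 0 ≤ lam 0 ^ 2 * (σ : ℝ) ^ 2 / (1 + ∑ k : Fin J, lam (k + 1) ^ 2 * (σ : ℝ) ^ 2) := by
    positivity
  simpa [condVar] using this

theorem condVar_le (J : ℕ) (σ : ℝ≥0) (lam : ℕ → ℝ) : condVar J σ lam ≤ 1 + lam 0 ^ 2 * (σ : ℝ) ^ 2 := by
  have : 0 ≤ ∑ k : Fin J, lam (k + 1) ^ 2 * (σ : ℝ) ^ 2 := by positivity
  unfold condVar
  gcongr
  exact div_le_self (by positivity) (by linarith)

section Model

variable {Ω : Type*} [MeasurableSpace Ω] {μ : Measure Ω}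

variable {σ : ℝ≥0} {F : ℕ → Ω → ℝ} {ε : ℕ → ℕ → Ω → ℝ}

namespace FactorAssumptions

theorem isGaussianProcess_elim (hA : FactorAssumptions μ σ F ε) :
    IsGaussianProcess (Sum.elim F fun p : ℕ × ℕ => ε p.1 p.2) μ where
  hasGaussianLaw I := by
    refine iIndepFun.hasGaussianLaw (X := fun i : I => Sum.elim F (fun p : ℕ × ℕ => ε p.1 p.2) i)
      (fun i => ?_) (hA.indep.precomp Subtype.val_injective)
    rcases i with ⟨t | p, hi⟩
    · exact (hA.law_F t).hasGaussianLaw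
    · exact (hA.law_ε p.1 p.2).hasGaussianLaw

theorem integral_F (hA : FactorAssumptions μ σ F ε) (t : ℕ) : ∫ ω, F t ω ∂μ = 0 := by
  rw [(hA.law_F t).integral_eq, integral_id_gaussianReal]

theorem integral_ε (hA : FactorAssumptions μ σ F ε) (i t : ℕ) : ∫ ω, ε i t ω ∂μ = 0 := by
  rw [(hA.law_ε i t).integral_eq, integral_id_gaussianReal]

theorem memLp_F (hA : FactorAssumptions μ σ F ε) (t : ℕ) : MemLp (F t) 2 μ :=
  (hA.law_F t).hasGaussianLaw.memLp_two

theorem memLp_ε (hA : FactorAssumptions μ σ F ε) (i t : ℕ) : MemLp (ε i t) 2 μ :=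
  (hA.law_ε i t).hasGaussianLaw.memLp_two

theorem cov_F (hA : FactorAssumptions μ σ F ε) (s t : ℕ) :
    cov[F s, F t; μ] = if s = t then (σ : ℝ) ^ 2 else 0 := by
  split_ifs with h
  · subst h
    rw [covariance_self (hA.law_F s).aemeasurable, (hA.law_F s).variance_eq,
      variance_id_gaussianReal]
    simp
  · exact (hA.indep.indepFun (i := Sum.inl s) (j := Sum.inl t) (by simpa)).covariance_eq_zero
      (hA.memLp_F s) (hA.memLp_F t)

theorem cov_ε (hA : FactorAssumptions μ σ F ε) (i j s t : ℕ) :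
    cov[ε i s, ε j t; μ] = if s = t ∧ i = j then 1 else 0 := by
  split_ifs with h
  · obtain ⟨rfl, rfl⟩ := h
    rw [covariance_self (hA.law_ε i s).aemeasurable, (hA.law_ε i s).variance_eq,
      variance_id_gaussianReal]
    simp
  · exact (hA.indep.indepFun (i := Sum.inr (i, s)) (j := Sum.inr (j, t))
      (by simpa using fun h1 h2 => h ⟨h2, h1⟩)).covariance_eq_zero
      (hA.memLp_ε i s) (hA.memLp_ε j t)

theorem cov_F_ε (hA : FactorAssumptions μ σ F ε) (s j t : ℕ) :
    cov[F s, ε j t; μ] = 0 :=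
  (hA.indep.indepFun (i := Sum.inl s) (j := Sum.inr (j, t)) (by simp)).covariance_eq_zero
    (hA.memLp_F s) (hA.memLp_ε j t)

variable (lam : ℕ → ℝ)

theorem isGaussianProcess_outcome (hA : FactorAssumptions μ σ F ε) :
    IsGaussianProcess (fun p : ℕ × ℕ => outcome lam F ε p.1 p.2) μ := by
  refine hA.isGaussianProcess_elim.of_isGaussianProcess fun p =>
    ⟨{Sum.inl p.2, Sum.inr (p.1, p.2)}, lam p.1 • ContinuousLinearMap.proj ⟨Sum.inl p.2, by simp⟩ +
      ContinuousLinearMap.proj ⟨Sum.inr (p.1, p.2), by simp⟩, fun ω => ?_⟩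
  simp [outcome]

theorem memLp_outcome (hA : FactorAssumptions μ σ F ε) (i t : ℕ) :
    MemLp (outcome lam F ε i t) 2 μ :=
  ((hA.isGaussianProcess_outcome lam).hasGaussianLaw_eval (i, t)).memLp_two

theorem integral_outcome [IsProbabilityMeasure μ] (hA : FactorAssumptions μ σ F ε) (i t : ℕ) :
    ∫ ω, outcome lam F ε i t ω ∂μ = 0 := by
  simp only [outcome]
  rw [integral_add (((hA.memLp_F t).integrable one_le_two).const_mul _)
    ((hA.memLp_ε i t).integrable one_le_two), integral_const_mul, hA.integral_F, hA.integral_ε]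
  simp

theorem cov_outcome [IsProbabilityMeasure μ] (hA : FactorAssumptions μ σ F ε) (i j s t : ℕ) :
    cov[outcome lam F ε i s, outcome lam F ε j t; μ] =
      if s = t then lam i * lam j * (σ : ℝ) ^ 2 + (if i = j then 1 else 0) else 0 := by
  have ho : ∀ i t, outcome lam F ε i t = (fun ω => lam i * F t ω) + ε i t := fun i t => rfl
  have hF : ∀ i t, MemLp (fun ω => lam i * F t ω) 2 μ := fun i t => (hA.memLp_F t).const_mul _
  rw [ho, ho, covariance_add_left (hF _ _) (hA.memLp_ε _ _) ((hF _ _).add (hA.memLp_ε _ _)),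
    covariance_add_right (hF _ _) (hF _ _) (hA.memLp_ε _ _),
    covariance_add_right (hA.memLp_ε _ _) (hF _ _) (hA.memLp_ε _ _)]
  simp only [covariance_const_mul_left, covariance_const_mul_right, hA.cov_F, hA.cov_ε,
    hA.cov_F_ε, covariance_comm (ε _ _) (F _)]
  by_cases h : s = t <;> by_cases h' : i = j <;> simp [h, h'] <;> ring

variable (J : ℕ)

theorem memLp_sum_outcome (hA : FactorAssumptions μ σ F ε) (w : Fin J → ℝ) (t : ℕ) :
    MemLp (fun ω => ∑ k : Fin J, w k * outcome lam F ε (k + 1) t ω) 2 μ :=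
  memLp_finsetSum _ fun _ _ => (hA.memLp_outcome lam _ _).const_mul _

theorem memLp_predError (hA : FactorAssumptions μ σ F ε) (t : ℕ) :
    MemLp (predError J σ lam F ε t) 2 μ := by
  rw [predError_eq]
  exact (hA.memLp_outcome lam _ _).sub (hA.memLp_sum_outcome lam J _ _)

theorem cov_predError_outcome [IsProbabilityMeasure μ] (hA : FactorAssumptions μ σ F ε)
    (j s t : ℕ) :
    cov[predError J σ lam F ε s, outcome lam F ε j t; μ] =
      if s = t then lam 0 * lam j * (σ : ℝ) ^ 2 + (if 0 = j then 1 else 0) -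
        ∑ k : Fin J, targetWeights J σ lam k *
          (lam (k + 1) * lam j * (σ : ℝ) ^ 2 + (if (k : ℕ) + 1 = j then 1 else 0)) else 0 := by
  rw [predError_eq, covariance_fun_sub_left (hA.memLp_outcome lam _ _)
    (hA.memLp_sum_outcome lam J _ _) (hA.memLp_outcome lam _ _),
    covariance_fun_sum_left (fun k => (hA.memLp_outcome lam _ _).const_mul _)
      (hA.memLp_outcome lam _ _)]
  simp only [covariance_const_mul_left, hA.cov_outcome]
  by_cases h : s = t <;> simp [h]

/-- The target weights solve the population normal equations. -/
theorem cov_predError_donor [IsProbabilityMeasure μ] (hA : FactorAssumptions μ σ F ε)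
    (j : Fin J) (s t : ℕ) :
    cov[predError J σ lam F ε s, outcome lam F ε (j + 1) t; μ] = 0 := by
  rw [hA.cov_predError_outcome]
  by_cases h : s = t
  · have h1 : ∀ k : Fin J, targetWeights J σ lam k *
          (lam (k + 1) * lam (j + 1) * (σ : ℝ) ^ 2 + (if (k : ℕ) + 1 = j + 1 then 1 else 0)) =
        lam (j + 1) * (targetWeights J σ lam k * lam (k + 1) * (σ : ℝ) ^ 2) +
          (if k = j then targetWeights J σ lam k else 0) := fun k => by
      by_cases hk : k = j
      · subst hk; simp; ring
      · have : ¬ (k : ℕ) = j := fun h => hk (Fin.ext h)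
        simp [hk, this]; ring
    rw [Finset.sum_congr rfl fun k _ => h1 k, Finset.sum_add_distrib, ← Finset.mul_sum,
      sum_targetWeights_mul, Finset.sum_ite_eq' Finset.univ j]
    simp [targetWeights, h]
    ring
  · simp [h]

theorem cov_predError [IsProbabilityMeasure μ] (hA : FactorAssumptions μ σ F ε) (s t : ℕ) :
    cov[predError J σ lam F ε s, predError J σ lam F ε t; μ] =
      if s = t then condVar J σ lam else 0 := by
  conv_lhs => rw [predError_eq _ _ _ lam J t]
  rw [covariance_fun_sub_right (hA.memLp_predError lam J s) (hA.memLp_outcome lam _ _)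
    (hA.memLp_sum_outcome lam J _ _),
    covariance_fun_sum_right (fun k => (hA.memLp_outcome lam _ _).const_mul _)
      (hA.memLp_predError lam J s)]
  simp only [covariance_const_mul_right, hA.cov_predError_donor, hA.cov_predError_outcome]
  have h1 : ∀ k : Fin J, targetWeights J σ lam k *
      (lam (k + 1) * lam 0 * (σ : ℝ) ^ 2 + (if (k : ℕ) + 1 = 0 then 1 else 0)) =
      lam 0 * (targetWeights J σ lam k * lam (k + 1) * (σ : ℝ) ^ 2) := fun k => by
    simp; ring
  rw [Finset.sum_congr rfl fun k _ => h1 k, ← Finset.mul_sum, sum_targetWeights_mul]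
  by_cases h : s = t
  · simp [h, condVar]; ring
  · simp [h]

theorem isGaussianProcess_elim_predError (hA : FactorAssumptions μ σ F ε) :
    IsGaussianProcess (Sum.elim (predError J σ lam F ε)
      (fun p : Fin J × ℕ => outcome lam F ε (p.1 + 1) p.2)) μ := by
  refine IsGaussianProcess.of_isGaussianProcess (hA.isGaussianProcess_outcome lam) fun s => ?_
  rcases s with t | p
  · refine ⟨insert (0, t) (Finset.univ.image fun k : Fin J => ((k : ℕ) + 1, t)),
      ContinuousLinearMap.proj ⟨(0, t), by simp⟩ - ∑ k : Fin J,
        targetWeights J σ lam k • ContinuousLinearMap.proj ⟨((k : ℕ) + 1, t), by simp⟩,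
      fun ω => ?_⟩
    simp [predError_eq]
  · exact ⟨{((p.1 : ℕ) + 1, p.2)}, ContinuousLinearMap.proj ⟨((p.1 : ℕ) + 1, p.2), by simp⟩,
      fun ω => by simp⟩

theorem isWhiteNoise_predError [IsProbabilityMeasure μ] (hA : FactorAssumptions μ σ F ε) :
    IsWhiteNoise (predError J σ lam F ε) (condVar J σ lam) μ where
  gaussian := (hA.isGaussianProcess_elim_predError lam J).comp_right Sum.inl
  mean t := by
    rw [predError_eq, integral_sub ((hA.memLp_outcome lam _ _).integrable one_le_two)
      ((hA.memLp_sum_outcome lam J _ _).integrable one_le_two), integral_finsetSum _ fun _ _ =>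
        ((hA.memLp_outcome lam _ _).integrable one_le_two).const_mul _]
    simp [integral_const_mul, hA.integral_outcome]
  cov := hA.cov_predError lam J

theorem errVar_eq [IsProbabilityMeasure μ] (hA : FactorAssumptions μ σ F ε) :
    errVar μ J σ lam F ε = condVar J σ lam := by
  simpa [sq, errVar] using (hA.isWhiteNoise_predError lam J).integral_mul 0 0

theorem aemeasurable_donors (hA : FactorAssumptions μ σ F ε) :
    AEMeasurable (fun ω t => donors J lam F ε t ω) μ := by
  refine aemeasurable_pi_lambda _ fun t => ?_
  exact (WithLp.measurable_toLp 2 (Fin J → ℝ)).comp_aemeasurable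
    (aemeasurable_pi_lambda _ fun j => (hA.memLp_outcome lam _ _).aemeasurable)

/-- Uncorrelated and jointly Gaussian, the prediction errors of all periods are independent of the
donor outcomes of all periods. -/
theorem indepFun_predError_donors [IsProbabilityMeasure μ] (hA : FactorAssumptions μ σ F ε) :
    IndepFun (fun ω t => predError J σ lam F ε t ω) (fun ω t => donors J lam F ε t ω) μ := by
  have h := (hA.isGaussianProcess_elim_predError lam J).indepFun_of_covariance_eq_zero
    (fun t => (hA.memLp_predError lam J t).aemeasurable)
    (fun p => (hA.memLp_outcome lam _ _).aemeasurable)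
    (fun s p => hA.cov_predError_donor lam J p.1 s p.2)
  exact h.comp (φ := id) (ψ := fun (x : Fin J × ℕ → ℝ) t =>
    (WithLp.toLp 2 fun j => x (j, t) : EuclideanSpace ℝ (Fin J))) measurable_id
    (measurable_pi_lambda _ fun t => (WithLp.measurable_toLp 2 (Fin J → ℝ)).comp
      (measurable_pi_lambda _ fun j => measurable_pi_apply _))

theorem integral_outcome_sq [IsProbabilityMeasure μ] (hA : FactorAssumptions μ σ F ε) (i t : ℕ) :
    ∫ ω, outcome lam F ε i t ω ^ 2 ∂μ = lam i ^ 2 * (σ : ℝ) ^ 2 + 1 := by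
  have h1 := covariance_eq_sub (hA.memLp_outcome lam i t) (hA.memLp_outcome lam i t)
  rw [hA.cov_outcome, hA.integral_outcome] at h1
  simp only [if_true] at h1
  simp only [sq] at h1 ⊢
  simpa using h1.symm

/-- The score `T⁻¹ ∑ₜ eₜ yₜ` has mean square `O(J / T)`. -/
theorem integral_norm_score_sq_le [IsProbabilityMeasure μ] (hA : FactorAssumptions μ σ F ε)
    (T : ℕ) {C : ℝ} (hC : ∀ i ≤ J, |lam i| ≤ C) :
    Integrable (fun ω => ‖(1 / (T : ℝ)) • ∑ t ∈ Finset.range T,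
        predError J σ lam F ε t ω • donors J lam F ε t ω‖ ^ 2) μ ∧
      ∫ ω, ‖(1 / (T : ℝ)) • ∑ t ∈ Finset.range T,
        predError J σ lam F ε t ω • donors J lam F ε t ω‖ ^ 2 ∂μ ≤
          (1 + C ^ 2 * (σ : ℝ) ^ 2) ^ 2 * ((J : ℝ) / T) := by
  have hsq : ∀ i ≤ J, lam i ^ 2 ≤ C ^ 2 := fun i hi => sq_le_sq' (by
    have := hC i hi; rw [abs_le] at this; linarith) (le_of_abs_le (hC i hi))
  have hexp : ∀ ω, ‖(1 / (T : ℝ)) • ∑ t ∈ Finset.range T,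
        predError J σ lam F ε t ω • donors J lam F ε t ω‖ ^ 2 = (1 / (T : ℝ)) ^ 2 *
      ∑ j : Fin J, (∑ t ∈ Finset.range T,
        predError J σ lam F ε t ω * outcome lam F ε (j + 1) t ω) ^ 2 := by
    intro ω
    rw [norm_smul, mul_pow, EuclideanSpace.real_norm_sq_eq]
    simp [donors]
  have hS := fun j : Fin J => (hA.isWhiteNoise_predError lam J).integral_sum_mul_sq
    (x := fun t => outcome lam F ε (j + 1) t) (fun t => hA.memLp_outcome lam _ _)
    ((hA.indepFun_predError_donors lam J).comp (φ := id)
      (ψ := fun (y : ℕ → EuclideanSpace ℝ (Fin J)) t => y t j) measurable_id (by fun_prop))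
    (Finset.range T)
  simp_rw [hexp]
  refine ⟨(integrable_finsetSum _ fun j _ => (hS j).1).const_mul _, ?_⟩
  rw [integral_const_mul, integral_finsetSum _ fun j _ => (hS j).1]
  have hle : ∀ j : Fin J, ∫ ω, (∑ t ∈ Finset.range T,
      predError J σ lam F ε t ω * outcome lam F ε (j + 1) t ω) ^ 2 ∂μ ≤
      (1 + C ^ 2 * (σ : ℝ) ^ 2) * (T * (1 + C ^ 2 * (σ : ℝ) ^ 2)) := by
    intro j
    rw [(hS j).2]
    simp only [hA.integral_outcome_sq, Finset.sum_const, Finset.card_range, nsmul_eq_mul]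
    have h1 := hsq 0 (Nat.zero_le _)
    have h2 := hsq (j + 1) j.2
    have h3 := condVar_le J σ lam
    have h4 := one_le_condVar J σ lam
    have h5 : lam (j + 1) ^ 2 * (σ : ℝ) ^ 2 + 1 ≤ 1 + C ^ 2 * (σ : ℝ) ^ 2 := by
      rw [add_comm]; gcongr
    have h6 : condVar J σ lam ≤ 1 + C ^ 2 * (σ : ℝ) ^ 2 := h3.trans (by gcongr)
    gcongr
  calc _ ≤ (1 / (T : ℝ)) ^ 2 * ∑ j : Fin J,
        ((1 + C ^ 2 * (σ : ℝ) ^ 2) * (T * (1 + C ^ 2 * (σ : ℝ) ^ 2))) := by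
        gcongr with j; exact hle j
    _ = _ := by
      rcases Nat.eq_zero_or_pos T with rfl | hT
      · simp
      · simp only [Finset.sum_const, Finset.card_univ, Fintype.card_fin, nsmul_eq_mul]
        field_simp

end FactorAssumptions

end Model

/-! ### The Gram matrix of a design -/

section Design

variable {J : ℕ}

/-- The Gram matrix `T⁻¹ ∑ₜ yₜ yₜ'` of a sequence of design vectors. -/
noncomputable def designGram (T : ℕ) (y : ℕ → EuclideanSpace ℝ (Fin J)) :
    Matrix (Fin J) (Fin J) ℝ :=
  (1 / (T : ℝ)) • ∑ t ∈ Finset.range T, Matrix.vecMulVec (y t).ofLp (y t).ofLp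

/-- The bilinear form of the Gram matrix. -/
noncomputable def designForm (T : ℕ) (y : ℕ → EuclideanSpace ℝ (Fin J))
    (u v : EuclideanSpace ℝ (Fin J)) : ℝ :=
  1 / (T : ℝ) * ∑ t ∈ Finset.range T, inner ℝ (y t) u * inner ℝ (y t) v

/-- The solution `D⁻¹ a` of the normal equations with right-hand side `a`. If the Gram matrix `D` is
singular, this is the junk value `0`. -/
noncomputable def designSolve (T : ℕ) (y : ℕ → EuclideanSpace ℝ (Fin J))
    (a : EuclideanSpace ℝ (Fin J)) : EuclideanSpace ℝ (Fin J) :=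
  WithLp.toLp 2 ((designGram T y)⁻¹ *ᵥ a.ofLp)

theorem inner_designGram_mulVec (T : ℕ) (y : ℕ → EuclideanSpace ℝ (Fin J))
    (u v : EuclideanSpace ℝ (Fin J)) :
    inner ℝ u (WithLp.toLp 2 (designGram T y *ᵥ v.ofLp)) = designForm T y u v := by
  have h : ∀ a b : EuclideanSpace ℝ (Fin J), inner ℝ a b = a.ofLp ⬝ᵥ b.ofLp := fun a b => by
    rw [EuclideanSpace.inner_eq_star_dotProduct, dotProduct_comm]; simp
  rw [h]
  simp only [designForm, designGram, h, Matrix.smul_mulVec, Matrix.sum_mulVec, dotProduct_smul,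
    dotProduct_sum, Matrix.vecMulVec_mulVec, smul_eq_mul, MulOpposite.smul_eq_mul_unop]
  congr 1
  refine Finset.sum_congr rfl fun t _ => ?_
  simp [dotProduct_comm u.ofLp]

variable {T : ℕ} {y : ℕ → EuclideanSpace ℝ (Fin J)}

theorem designForm_comm (u v : EuclideanSpace ℝ (Fin J)) :
    designForm T y u v = designForm T y v u := by
  simp only [designForm, mul_comm]

theorem designForm_sub_sub (u v : EuclideanSpace ℝ (Fin J)) :
    designForm T y (u - v) (u - v) =
      designForm T y u u - 2 * designForm T y u v + designForm T y v v := by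
  simp only [designForm, inner_sub_right]
  rw [← mul_assoc, mul_comm 2 (1 / (T : ℝ)), mul_assoc, ← mul_sub, ← mul_add, Finset.mul_sum _ _ (2 : ℝ),
    ← Finset.sum_sub_distrib, ← Finset.sum_add_distrib]
  congr 1
  exact Finset.sum_congr rfl fun t _ => by ring

theorem designForm_designSolve {c : ℝ} (hc : 0 < c) (h : ∀ u, c * ‖u‖ ^ 2 ≤ designForm T y u u)
    (a u : EuclideanSpace ℝ (Fin J)) : designForm T y u (designSolve T y a) = inner ℝ u a := by
  have hdet : IsUnit (designGram T y).det := by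
    rw [isUnit_iff_ne_zero]
    intro h0
    obtain ⟨v, hv, hv0⟩ := Matrix.exists_mulVec_eq_zero_iff.2 h0
    have h1 := h (WithLp.toLp 2 v)
    rw [← inner_designGram_mulVec] at h1
    simp only [hv0] at h1
    have h2 : (0 : ℝ) < ‖WithLp.toLp 2 v‖ := norm_pos_iff.2 (by simpa using hv)
    have : 0 < c * ‖WithLp.toLp 2 v‖ ^ 2 := by positivity
    simp at h1
    linarith
  rw [← inner_designGram_mulVec]
  simp [designSolve, Matrix.mulVec_mulVec, Matrix.mul_nonsing_inv _ hdet]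

theorem norm_designSolve_le {c : ℝ} (hc : 0 < c) (h : ∀ u, c * ‖u‖ ^ 2 ≤ designForm T y u u)
    (a : EuclideanSpace ℝ (Fin J)) : ‖designSolve T y a‖ ≤ ‖a‖ / c := by
  have h1 := h (designSolve T y a)
  rw [designForm_designSolve hc h] at h1
  have h2 := real_inner_le_norm (designSolve T y a) a
  rcases (norm_nonneg (designSolve T y a)).eq_or_lt with h0 | h0
  · rw [← h0]; positivity
  · rw [le_div_iff₀ hc]
    nlinarith

theorem continuous_designGram (T : ℕ) : Continuous (designGram (J := J) T) := by
  unfold designGram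
  fun_prop

/-- By Cramer's rule, `D⁻¹ a` is a quotient of continuous functions of the design. -/
theorem measurable_designSolve (T : ℕ) (a : EuclideanSpace ℝ (Fin J)) :
    Measurable fun y => designSolve T y a := by
  have h : ∀ y, designSolve T y a = (designGram T y).det⁻¹ •
      WithLp.toLp 2 ((designGram T y).adjugate *ᵥ a.ofLp) := fun y => by
    simp [designSolve, Matrix.inv_def, Ring.inverse_eq_inv', Matrix.smul_mulVec]
  simp_rw [h]
  have h1 : Continuous fun y => (designGram (J := J) T y).det :=
    (continuous_designGram T).matrix_det
  have h2 : Continuous fun y => (WithLp.toLp 2 ((designGram T y).adjugate *ᵥ a.ofLp) :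
      EuclideanSpace ℝ (Fin J)) :=
    (PiLp.continuous_toLp 2 _).comp
      ((continuous_designGram T).matrix_adjugate.matrix_mulVec continuous_const)
  exact h1.measurable.inv.smul h2.measurable

theorem isClosed_setOf_le_designForm (T : ℕ) (c : ℝ) :
    IsClosed {y : ℕ → EuclideanSpace ℝ (Fin J) | ∀ u, c * ‖u‖ ^ 2 ≤ designForm T y u u} := by
  simp only [Set.ofPred_forall]
  refine isClosed_iInter fun u => isClosed_le continuous_const ?_
  unfold designForm
  fun_prop

/-- The coefficients, of norm one, of the studentized linear functional `a` of the least squares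
estimator. Where the formula does not give norm one (a singular Gram matrix or `a = 0`), the first
unit vector is taken instead. -/
noncomputable def studentCoef (T : ℕ) (a : EuclideanSpace ℝ (Fin J))
    (y : ℕ → EuclideanSpace ℝ (Fin J)) : ℕ → ℝ :=
  let u : ℕ → ℝ := fun t =>
    inner ℝ (y t) (designSolve T y a) / Real.sqrt (T * inner ℝ a (designSolve T y a))
  if ∑ t ∈ Finset.range T, u t ^ 2 = 1 then u else Pi.single 0 1

theorem sum_studentCoef_sq (hT : 0 < T) (a : EuclideanSpace ℝ (Fin J)) :
    ∑ t ∈ Finset.range T, studentCoef T a y t ^ 2 = 1 := by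
  simp only [studentCoef]
  split_ifs with h
  · exact h
  · rw [Finset.sum_eq_single_of_mem 0 (Finset.mem_range.2 hT)]
    · simp
    · intro t _ ht
      simp [ht]

theorem measurable_studentCoef (T : ℕ) (a : EuclideanSpace ℝ (Fin J)) :
    Measurable (studentCoef T a) := by
  have h := measurable_designSolve T a
  have h1 : Measurable fun (y : ℕ → EuclideanSpace ℝ (Fin J)) (t : ℕ) =>
      inner ℝ (y t) (designSolve T y a) / Real.sqrt (T * inner ℝ a (designSolve T y a)) := by
    refine measurable_pi_lambda _ fun t => ?_
    exact ((measurable_pi_apply t).inner h).div ((measurable_const.inner h).const_mul _).sqrt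
  unfold studentCoef
  refine Measurable.ite ?_ h1 measurable_const
  exact measurableSet_eq_fun (by fun_prop) measurable_const

theorem studentCoef_of_pos {c : ℝ} (hc : 0 < c) (h : ∀ u, c * ‖u‖ ^ 2 ≤ designForm T y u u)
    (hT : 0 < T) {a : EuclideanSpace ℝ (Fin J)} (ha : a ≠ 0) :
    0 < inner ℝ a (designSolve T y a) ∧ ∀ t, studentCoef T a y t =
      inner ℝ (y t) (designSolve T y a) / Real.sqrt (T * inner ℝ a (designSolve T y a)) := by
  set g := designSolve T y a with hg
  have hag : inner ℝ a g = designForm T y g g := by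
    rw [hg, designForm_designSolve hc h, real_inner_comm]
  have hg0 : g ≠ 0 := by
    intro h0
    have h1 := designForm_designSolve hc h a a
    rw [← hg, h0] at h1
    simp only [designForm, inner_zero_right, mul_zero, Finset.sum_const_zero] at h1
    exact ha (inner_self_eq_zero.1 h1.symm)
  have hpos : 0 < inner ℝ a g := by
    rw [hag]
    have : 0 < ‖g‖ := norm_pos_iff.2 hg0
    exact lt_of_lt_of_le (by positivity) (h g)
  have hT' : (0 : ℝ) < T := by exact_mod_cast hT
  refine ⟨hpos, fun t => ?_⟩
  simp only [studentCoef, ← hg]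
  rw [if_pos]
  simp only [div_pow]
  rw [← Finset.sum_div, Real.sq_sqrt (by positivity), div_eq_one_iff_eq (by positivity), hag,
    designForm]
  simp only [sq]
  field_simp

end Design

/-! ### Deterministic analysis of the maximizer -/

/-- If a Gaussian likelihood with empirical risk `S` and variance `Σ` is at least the one with
empirical risk `s` and variance `v`, then `S` exceeds `s` by at most a quadratic function of the
relative error of `s` as an estimate of `v`. -/
theorem sub_le_of_log_add_div_le {v s S Sig : ℝ} (hv : 0 < v) (hs : 0 < s) (hS : 0 ≤ S)
    (hSig : 0 < Sig) (h : Real.log Sig + S / Sig ≤ Real.log v + s / v) :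
    S - s ≤ v * Real.exp (s / v) * ((s / v - 1) ^ 2 / (s / v)) := by
  -- As `S ≥ 0`, the hypothesis bounds `Σ`, which turns a bound on `(S - s) / Σ` into one on `S - s`.
  have h1 : Sig ≤ v * Real.exp (s / v) := by
    rw [← Real.log_le_log_iff hSig (by positivity), Real.log_mul hv.ne' (Real.exp_pos _).ne',
      Real.log_exp]
    have : 0 ≤ S / Sig := by positivity
    linarith
  have h2 := Real.log_le_sub_one_of_pos (div_pos hs hSig)
  rw [Real.log_div hs.ne' hSig.ne'] at h2
  have h3 := Real.one_sub_inv_le_log_of_pos (div_pos hs hv)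
  rw [Real.log_div hs.ne' hv.ne'] at h3
  have h4 : (s / v - 1) ^ 2 / (s / v) = s / v + (s / v)⁻¹ - 2 := by
    field_simp
    ring
  have h5 : (S - s) / Sig ≤ (s / v - 1) ^ 2 / (s / v) := by
    rw [sub_div, h4]
    linarith
  have h6 : 0 ≤ (s / v - 1) ^ 2 / (s / v) := by positivity
  rw [div_le_iff₀ hSig] at h5
  calc S - s ≤ (s / v - 1) ^ 2 / (s / v) * Sig := h5
    _ ≤ (s / v - 1) ^ 2 / (s / v) * (v * Real.exp (s / v)) := by gcongr
    _ = _ := by ring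

/-- The Gaussian likelihood with empirical risk `s + q` never exceeds the maximal one with empirical
risk `s` unless `q ≤ 0`. -/
theorem nonpos_of_log_add_div_le {s q Sig : ℝ} (hs : 0 < s) (hSig : 0 < Sig)
    (h : Real.log Sig + (s + q) / Sig ≤ Real.log s + 1) : q ≤ 0 := by
  have h2 := Real.log_le_sub_one_of_pos (div_pos hs hSig)
  rw [Real.log_div hs.ne' hSig.ne'] at h2
  rw [add_div] at h
  have h3 : q / Sig ≤ 0 := by linarith
  rw [div_le_iff₀ hSig] at h3
  simpa using h3

section Likelihood

variable {Ω : Type*} {J T : ℕ} {σ : ℝ≥0} {lam : ℕ → ℝ} {F : ℕ → Ω → ℝ} {ε : ℕ → ℕ → Ω → ℝ}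
  {ω : Ω}

/-- The mean squared prediction error at the target weights. -/
noncomputable def targetRisk (J T : ℕ) (σ : ℝ≥0) (lam : ℕ → ℝ) (F : ℕ → Ω → ℝ)
    (ε : ℕ → ℕ → Ω → ℝ) (ω : Ω) : ℝ :=
  (1 / (T : ℝ)) * ∑ t ∈ Finset.range T, predError J σ lam F ε t ω ^ 2

/-- The score `T⁻¹ ∑ₜ eₜ yₜ` at the target weights. -/
noncomputable def score (J T : ℕ) (σ : ℝ≥0) (lam : ℕ → ℝ) (F : ℕ → Ω → ℝ)
    (ε : ℕ → ℕ → Ω → ℝ) (ω : Ω) : EuclideanSpace ℝ (Fin J) :=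
  (1 / (T : ℝ)) • ∑ t ∈ Finset.range T, predError J σ lam F ε t ω • donors J lam F ε t ω

/-- The mean squared residual as a quadratic function of the deviation from the target weights. -/
theorem risk_eq (w : EuclideanSpace ℝ (Fin J)) :
    (1 / (T : ℝ)) * ∑ t ∈ Finset.range T,
        (outcome lam F ε 0 t ω - inner ℝ (donors J lam F ε t ω) w) ^ 2 =
      targetRisk J T σ lam F ε ω -
        2 * inner ℝ (w - targetWeights J σ lam) (score J T σ lam F ε ω) +
        designForm T (fun t => donors J lam F ε t ω) (w - targetWeights J σ lam)
          (w - targetWeights J σ lam) := by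
  simp only [targetRisk, score, designForm, inner_smul_right, inner_sum]
  rw [← mul_assoc, mul_comm 2 (1 / (T : ℝ)), mul_assoc, ← mul_sub, ← mul_add, Finset.mul_sum _ _ (2 : ℝ),
    ← Finset.sum_sub_distrib, ← Finset.sum_add_distrib]
  congr 1
  refine Finset.sum_congr rfl fun t _ => ?_
  rw [real_inner_comm (donors J lam F ε t ω) (w - _), inner_sub_right]
  simp only [predError]
  ring

theorem logLik_eq (w : EuclideanSpace ℝ (Fin J)) {S : ℝ} (hS : 0 < S) :
    logLik J T lam F ε ω (w, S) = -(1 / 2) * (Real.log (2 * Real.pi) + (Real.log S +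
      ((1 / (T : ℝ)) * ∑ t ∈ Finset.range T,
        (outcome lam F ε 0 t ω - inner ℝ (donors J lam F ε t ω) w) ^ 2) / S)) := by
  simp only [logLik]
  rw [Real.log_mul (by positivity) hS.ne', ← Finset.mul_sum]
  field_simp
  ring

variable {Θ : Set (EuclideanSpace ℝ (Fin J) × ℝ)} {θ : EuclideanSpace ℝ (Fin J) × ℝ} {c : ℝ}

/-- Only the comparison of the maximizer with the target parameter is used, so that `Θ` may be any
set containing the target. -/
theorem norm_sq_le_of_isMaxOn {v a : ℝ} (hc : 0 < c)
    (hq : ∀ u, c * ‖u‖ ^ 2 ≤ designForm T (fun t => donors J lam F ε t ω) u u)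
    (hpos : ∀ θ ∈ Θ, 0 < θ.2) (hmem : (targetWeights J σ lam, v) ∈ Θ) (hθ : θ ∈ Θ)
    (hmax : IsMaxOn (logLik J T lam F ε ω) Θ θ) (hv : 1 ≤ v)
    (ha : |targetRisk J T σ lam F ε ω - v| ≤ a) (ha2 : a ≤ 1 / 2) :
    ‖θ.1 - targetWeights J σ lam‖ ^ 2 ≤ 4 / c ^ 2 * ‖score J T σ lam F ε ω‖ ^ 2 +
      4 / c * (v * Real.exp (3 / 2) * a ^ 2) := by
  have hle := hmax hmem
  obtain ⟨w, S⟩ := θ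
  simp only [Set.mem_ofPred_eq] at hle
  have hS : 0 < S := hpos _ hθ
  rw [logLik_eq _ hS, logLik_eq _ (by linarith), risk_eq (σ := σ), risk_eq (σ := σ)] at hle
  simp only [sub_self, inner_zero_left, designForm, inner_zero_right, mul_zero,
    Finset.sum_const_zero, sub_zero, add_zero] at hle
  have hR0 : 0 ≤ (1 / (T : ℝ)) * ∑ t ∈ Finset.range T,
      (outcome lam F ε 0 t ω - inner ℝ (donors J lam F ε t ω) w) ^ 2 := by positivity
  rw [risk_eq (σ := σ)] at hR0
  set δ := w - targetWeights J σ lam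
  set b := score J T σ lam F ε ω
  set s := targetRisk J T σ lam F ε ω
  have hs := abs_le.1 ha
  set x := s / v with hx
  have hx1 : |x - 1| ≤ a := by
    rw [hx, div_sub_one (by linarith), abs_div, abs_of_pos (by linarith : (0 : ℝ) < v)]
    exact (div_le_self (abs_nonneg _) hv).trans ha
  have hx2 := abs_le.1 hx1
  have hcmp := sub_le_of_log_add_div_le (v := v) (s := s) (by linarith) (by linarith) hR0 hS
    (by simp only [designForm]; linarith)
  rw [← hx] at hcmp
  have hsq : (x - 1) ^ 2 / x ≤ 2 * a ^ 2 := by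
    rw [div_le_iff₀ (by linarith)]
    have : (x - 1) ^ 2 ≤ a ^ 2 := sq_le_sq' hx2.1 hx2.2
    nlinarith [sq_nonneg a]
  have hexp : Real.exp x ≤ Real.exp (3 / 2) := Real.exp_le_exp.2 (by linarith)
  have hgap : v * Real.exp x * ((x - 1) ^ 2 / x) ≤ v * Real.exp (3 / 2) * (2 * a ^ 2) := by
    have : 0 < x := by linarith
    have : 0 < v := by linarith
    gcongr
  have hq' := hq δ
  have hin := real_inner_le_norm δ b
  -- Young's inequality absorbs the cross term into half of the curvature.
  have hyoung : 2 * (‖δ‖ * ‖b‖) ≤ c / 2 * ‖δ‖ ^ 2 + 2 / c * ‖b‖ ^ 2 := by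
    have h0 : 0 ≤ (c * ‖δ‖ - 2 * ‖b‖) ^ 2 / (2 * c) := by positivity
    have h1 : (c * ‖δ‖ - 2 * ‖b‖) ^ 2 / (2 * c) =
        c / 2 * ‖δ‖ ^ 2 + 2 / c * ‖b‖ ^ 2 - 2 * (‖δ‖ * ‖b‖) := by
      field_simp
      ring
    linarith
  have hfin : c / 2 * ‖δ‖ ^ 2 ≤ 2 / c * ‖b‖ ^ 2 + v * Real.exp (3 / 2) * (2 * a ^ 2) := by
    linarith
  calc ‖δ‖ ^ 2 = 2 / c * (c / 2 * ‖δ‖ ^ 2) := by field_simp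
    _ ≤ 2 / c * (2 / c * ‖b‖ ^ 2 + v * Real.exp (3 / 2) * (2 * a ^ 2)) := by gcongr
    _ = _ := by field_simp; ring

/-- If `Θ` contains a ball around the target and the unconstrained maximizer (the least squares
estimator with its mean squared residual) falls in this ball, the maximizer over `Θ` is the least
squares estimator. -/
theorem eq_designSolve_of_isMaxOn {v r : ℝ} (hc : 0 < c)
    (hq : ∀ u, c * ‖u‖ ^ 2 ≤ designForm T (fun t => donors J lam F ε t ω) u u)
    (hpos : ∀ θ ∈ Θ, 0 < θ.2) (hball : Metric.ball (targetWeights J σ lam, v) r ⊆ Θ) (hθ : θ ∈ Θ)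
    (hmax : IsMaxOn (logLik J T lam F ε ω) Θ θ) (hb : ‖score J T σ lam F ε ω‖ / c < r)
    (hs : |targetRisk J T σ lam F ε ω - v| + ‖score J T σ lam F ε ω‖ ^ 2 / c < r) :
    θ.1 - targetWeights J σ lam =
      designSolve T (fun t => donors J lam F ε t ω) (score J T σ lam F ε ω) := by
  obtain ⟨w, S⟩ := θ
  have hS : 0 < S := hpos _ hθ
  set y := fun t => donors J lam F ε t ω with hy
  set b := score J T σ lam F ε ω
  set s := targetRisk J T σ lam F ε ω
  set η := designSolve T y b with hη
  have hηn : ‖η‖ ≤ ‖b‖ / c := norm_designSolve_le hc hq b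
  have hηη : designForm T y η η = inner ℝ η b := designForm_designSolve hc hq b η
  have hηb : inner ℝ η b ≤ ‖b‖ ^ 2 / c := (real_inner_le_norm η b).trans (by
    calc ‖η‖ * ‖b‖ ≤ ‖b‖ / c * ‖b‖ := by gcongr
      _ = _ := by ring)
  have hη0 : 0 ≤ inner ℝ η b := by
    rw [← hηη]; exact (by positivity : 0 ≤ c * ‖η‖ ^ 2).trans (hq η)
  have hmem : (targetWeights J σ lam + η, s - inner ℝ η b) ∈ Θ := by
    refine hball ?_
    rw [Metric.mem_ball, Prod.dist_eq, max_lt_iff]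
    constructor
    · simpa using hηn.trans_lt hb
    · rw [Real.dist_eq]
      have h1 := abs_le.1 (le_refl |s - v|)
      rw [abs_lt]
      constructor <;> linarith
  have hS' : 0 < s - inner ℝ η b := hpos _ hmem
  have hle := hmax hmem
  simp only [Set.mem_ofPred_eq] at hle
  rw [logLik_eq _ hS, logLik_eq _ hS', risk_eq (σ := σ), risk_eq (σ := σ)] at hle
  simp only [add_sub_cancel_left, ← hy] at hle
  set δ := w - targetWeights J σ lam
  have hδ : designForm T y (δ - η) (δ - η) =
      designForm T y δ δ - 2 * inner ℝ δ b + inner ℝ η b := by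
    rw [designForm_sub_sub, hηη, hη, designForm_designSolve hc hq b δ]
  -- Completing the square at `η`: the risk at `w̃ + δ` is the minimal risk plus the form at `δ - η`.
  have hval : s - 2 * inner ℝ η b + designForm T y η η = s - inner ℝ η b := by
    rw [hηη]; ring
  rw [hval, div_self hS'.ne'] at hle
  have hval' : s - 2 * inner ℝ δ b + designForm T y δ δ =
      (s - inner ℝ η b) + designForm T y (δ - η) (δ - η) := by
    rw [hδ]; ring
  rw [hval'] at hle
  have h0 := nonpos_of_log_add_div_le hS' hS (by linarith)
  have h1 := (hq (δ - η)).trans h0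
  have h2 : ‖δ - η‖ ^ 2 ≤ 0 := by
    by_contra hcon
    push Not at hcon
    have := mul_pos hc hcon
    linarith
  have h3 : ‖δ - η‖ = 0 := by
    have := sq_nonneg ‖δ - η‖
    exact pow_eq_zero_iff two_ne_zero |>.1 (le_antisymm h2 this)
  exact sub_eq_zero.1 (norm_eq_zero.1 h3)

/-- The studentized least squares estimator is a combination of the prediction errors with
coefficients of norm one that depend on the donors alone. -/
theorem student_eq_sum {v : ℝ} (hv : 0 < v) (hc : 0 < c)
    (hq : ∀ u, c * ‖u‖ ^ 2 ≤ designForm T (fun t => donors J lam F ε t ω) u u) (hT : 0 < T)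
    {α : EuclideanSpace ℝ (Fin J)} (hα : α ≠ 0) :
    Real.sqrt T * inner ℝ α
        (designSolve T (fun t => donors J lam F ε t ω) (score J T σ lam F ε ω)) /
      Real.sqrt (v * inner ℝ α (designSolve T (fun t => donors J lam F ε t ω) α)) =
    (∑ t ∈ Finset.range T, studentCoef T α (fun t => donors J lam F ε t ω) t *
      predError J σ lam F ε t ω) / Real.sqrt v := by
  obtain ⟨hN, hu⟩ := studentCoef_of_pos hc hq hT hα
  have hT' : (0 : ℝ) < T := by exact_mod_cast hT
  simp only [hu]
  set y := fun t => donors J lam F ε t ω with hy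
  set g := designSolve T y α with hg
  set η := designSolve T y (score J T σ lam F ε ω) with hη
  have h1 : inner ℝ α η = inner ℝ g (score J T σ lam F ε ω) := by
    rw [real_inner_comm, ← designForm_designSolve hc hq α η, ← hg, designForm_comm, hη,
      designForm_designSolve hc hq]
  have h2 : inner ℝ g (score J T σ lam F ε ω) =
      1 / (T : ℝ) * ∑ t ∈ Finset.range T, inner ℝ (y t) g * predError J σ lam F ε t ω := by
    simp only [score, inner_smul_right, inner_sum, hy]
    congr 1
    exact Finset.sum_congr rfl fun t _ => by rw [real_inner_comm, mul_comm]
  rw [h1, h2]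
  simp_rw [div_mul_eq_mul_div]
  rw [← Finset.sum_div, Real.sqrt_mul hv.le, Real.sqrt_mul hT'.le]
  have hsT : Real.sqrt T ^ 2 = T := Real.sq_sqrt hT'.le
  have h3 : 0 < Real.sqrt T := Real.sqrt_pos.2 hT'
  have h4 : 0 < Real.sqrt v := Real.sqrt_pos.2 hv
  have h5 : 0 < Real.sqrt (inner ℝ α g) := Real.sqrt_pos.2 hN
  field_simp
  rw [hsT]

/-- The smallest eigenvalue bounds the quadratic form from below, by the spectral decomposition. -/
theorem le_designForm_of_lt_gramMin {c : ℝ} (h : ENNReal.ofReal c < gramMin J T lam F ε ω)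
    (u : EuclideanSpace ℝ (Fin J)) :
    c * ‖u‖ ^ 2 ≤ designForm T (fun t => donors J lam F ε t ω) u u := by
  have hH := gram_isHermitian J T lam F ε ω
  have hc : ∀ i, c ≤ hH.eigenvalues i := by
    intro i
    have h1 := h.trans_le (iInf_le _ i)
    exact (ENNReal.ofReal_lt_ofReal_iff'.1 h1).1.le
  have hev : ∀ i, designForm T (fun t => donors J lam F ε t ω) (hH.eigenvectorBasis i) u =
      hH.eigenvalues i * inner ℝ (hH.eigenvectorBasis i) u := by
    intro i
    have h1 := inner_designGram_mulVec T (fun t => donors J lam F ε t ω) u (hH.eigenvectorBasis i)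
    have h2 := hH.mulVec_eigenvectorBasis i
    have h3 : designGram T (fun t => donors J lam F ε t ω) = gram J T lam F ε ω := rfl
    rw [h3, h2] at h1
    rw [designForm_comm, ← h1]
    simp only [WithLp.toLp_smul, WithLp.toLp_ofLp, inner_smul_right]
    rw [real_inner_comm]
  have hsum : designForm T (fun t => donors J lam F ε t ω) u u =
      ∑ i, hH.eigenvalues i * inner ℝ (hH.eigenvectorBasis i) u ^ 2 := by
    rw [← inner_designGram_mulVec, ← hH.eigenvectorBasis.sum_inner_mul_inner]
    refine Finset.sum_congr rfl fun i _ => ?_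
    rw [inner_designGram_mulVec, hev, real_inner_comm]
    ring
  rw [hsum, ← hH.eigenvectorBasis.sum_sq_inner_right, Finset.mul_sum]
  gcongr with i
  exact hc i

end Likelihood

/-! ### High-probability events -/

variable {Ω : Type*} [MeasurableSpace Ω] {μ : Measure Ω}

/-- If almost every point lies in eventually all sets of some row `P k` of a family, the rows
growing with `k`, then a single row contains the point eventually with probability close to one. -/
theorem exists_eventually_measure_compl_le [IsFiniteMeasure μ] {P : ℕ → ℕ → Set Ω}
    (hP : ∀ k n, NullMeasurableSet (P k n) μ) (hmono : ∀ n, Monotone fun k => P k n)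
    (h : ∀ᵐ ω ∂μ, ∃ k, ∀ᶠ n in atTop, ω ∈ P k n) {δ : ℝ≥0∞} (hδ : 0 < δ) :
    ∃ k, ∀ᶠ n in atTop, μ (P k n)ᶜ ≤ δ := by
  -- The event that row `k` fails somewhere from index `k` on; these events decrease to a null set.
  set A : ℕ → Set Ω := fun k => ⋃ n, ⋃ (_ : k ≤ n), (P k n)ᶜ with hA
  have hanti : Antitone A := by
    intro k l hkl ω hω
    simp only [hA, Set.mem_iUnion, Set.mem_compl_iff] at hω ⊢
    obtain ⟨n, hn, hω⟩ := hω
    exact ⟨n, hkl.trans hn, fun h => hω (hmono n hkl h)⟩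
  have hnull : ∀ k, NullMeasurableSet (A k) μ := fun k =>
    .iUnion fun n => .iUnion fun _ => (hP k n).compl
  have hinter : μ (⋂ k, A k) = 0 := by
    refine measure_mono_null (fun ω hω => ?_) (ae_iff.1 h)
    rintro ⟨k, hk⟩
    obtain ⟨N, hN⟩ := eventually_atTop.1 hk
    have h1 := Set.mem_iInter.1 hω (max k N)
    simp only [hA, Set.mem_iUnion, Set.mem_compl_iff] at h1
    obtain ⟨n, hn, hω⟩ := h1
    exact hω (hmono n (le_max_left k N) (hN n ((le_max_right k N).trans hn)))
  have hlim := tendsto_measure_iInter_atTop hnull hanti ⟨0, measure_ne_top μ _⟩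
  rw [hinter] at hlim
  obtain ⟨k, hk⟩ := (hlim.eventually_le_const hδ).exists
  refine ⟨k, eventually_atTop.2 ⟨k, fun n hn => (measure_mono ?_).trans hk⟩⟩
  exact Set.subset_iUnion₂_of_subset n hn subset_rfl

section Events

variable {σ : ℝ≥0} {F : ℕ → Ω → ℝ} {ε : ℕ → ℕ → Ω → ℝ} {J T : ℕ → ℕ} {lam : ℕ → ℕ → ℝ}

namespace FactorAssumptions

theorem exists_eventually_le_designForm [IsProbabilityMeasure μ] (hA : FactorAssumptions μ σ F ε)
    (hD : ∀ᵐ ω ∂μ,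
      0 < liminf (fun n => gramMin (J n) (T n) (lam n) F ε ω) atTop) {δ : ℝ≥0∞} (hδ : 0 < δ) :
    ∃ c : ℝ, 0 < c ∧ ∀ᶠ n in atTop, μ {ω | ¬ ∀ u,
      c * ‖u‖ ^ 2 ≤ designForm (T n) (fun t => donors (J n) (lam n) F ε t ω) u u} ≤ δ := by
  obtain ⟨k, hk⟩ := exists_eventually_measure_compl_le (μ := μ)
    (P := fun k n => {ω | ∀ u, 1 / ((k : ℝ) + 1) * ‖u‖ ^ 2 ≤
      designForm (T n) (fun t => donors (J n) (lam n) F ε t ω) u u})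
    (fun k n => (hA.aemeasurable_donors (lam n) (J n)).nullMeasurable
      (isClosed_setOf_le_designForm (T n) (1 / ((k : ℝ) + 1))).measurableSet)
    (fun n k l hkl ω hω u => le_trans
      (mul_le_mul_of_nonneg_right (one_div_le_one_div_of_le (by positivity) (by simpa))
        (by positivity)) (hω u))
    (by
      filter_upwards [hD] with ω hω
      obtain ⟨c, hc0, hc⟩ := ENNReal.lt_iff_exists_nnreal_btwn.1 hω
      obtain ⟨k, hk⟩ := exists_nat_one_div_lt (show (0 : ℝ) < c by exact_mod_cast hc0)
      refine ⟨k, ?_⟩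
      filter_upwards [eventually_lt_of_lt_liminf hc] with n hn
      exact le_designForm_of_lt_gramMin (lt_of_le_of_lt
        ((ENNReal.ofReal_le_ofReal hk.le).trans_eq (ENNReal.ofReal_coe_nnreal)) hn)) hδ
  exact ⟨1 / ((k : ℝ) + 1), by positivity, hk⟩

theorem exists_measure_score_le [IsProbabilityMeasure μ] (hA : FactorAssumptions μ σ F ε)
    (hlam : ∃ C : ℝ, ∀ n, ∀ i ≤ J n, |lam n i| ≤ C) {δ : ℝ≥0∞} (hδ : 0 < δ) :
    ∃ B : ℝ, 0 < B ∧ ∀ n, 0 < J n → 0 < T n →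
      μ {ω | B * ((J n : ℝ) / T n) < ‖score (J n) (T n) σ (lam n) F ε ω‖ ^ 2} ≤ δ := by
  obtain ⟨C, hC⟩ := hlam
  obtain ⟨d, hd0, hd⟩ := ENNReal.lt_iff_exists_nnreal_btwn.1 hδ
  have hd0' : (0 : ℝ) < d := by exact_mod_cast hd0
  set K : ℝ := (1 + C ^ 2 * (σ : ℝ) ^ 2) ^ 2
  have hK : 0 < K := by positivity
  refine ⟨K / d, by positivity, fun n hJ hT => ?_⟩
  obtain ⟨hint, hle⟩ := hA.integral_norm_score_sq_le (lam n) (J n) (T n) (hC n)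
  have hJ' : (0 : ℝ) < J n := by exact_mod_cast hJ
  have hT' : (0 : ℝ) < T n := by exact_mod_cast hT
  have hM := mul_meas_ge_le_integral_of_nonneg (μ := μ)
    (.of_forall fun ω => sq_nonneg _) hint (K / d * ((J n : ℝ) / T n))
  have h1 := hM.trans hle
  refine le_trans ?_ hd.le
  calc μ {ω | K / d * ((J n : ℝ) / T n) < ‖score (J n) (T n) σ (lam n) F ε ω‖ ^ 2}
      ≤ μ {ω | K / d * ((J n : ℝ) / T n) ≤ ‖score (J n) (T n) σ (lam n) F ε ω‖ ^ 2} :=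
        measure_mono fun ω hω => by
          simp only [Set.mem_ofPred_eq] at hω ⊢
          exact hω.le
    _ ≤ d := by
      rw [← ENNReal.ofReal_coe_nnreal, ← ofReal_measureReal]
      refine ENNReal.ofReal_le_ofReal ?_
      have h2 : 0 < K / d * ((J n : ℝ) / T n) := by positivity
      refine le_of_mul_le_mul_left (h1.trans_eq ?_) h2
      change K * ((J n : ℝ) / T n) = K / d * ((J n : ℝ) / T n) * d
      field_simp

theorem exists_measure_targetRisk_le [IsProbabilityMeasure μ] (hA : FactorAssumptions μ σ F ε)
    (hlam : ∃ C : ℝ, ∀ n, ∀ i ≤ J n, |lam n i| ≤ C) {δ : ℝ≥0∞} (hδ : 0 < δ) :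
    ∃ A : ℝ, 0 < A ∧ ∀ n, 0 < T n →
      μ {ω | A / Real.sqrt (T n) ≤
        |targetRisk (J n) (T n) σ (lam n) F ε ω - condVar (J n) σ (lam n)|} ≤ δ := by
  obtain ⟨C, hC⟩ := hlam
  obtain ⟨d, hd0, hd⟩ := ENNReal.lt_iff_exists_nnreal_btwn.1 hδ
  have hd0' : (0 : ℝ) < d := by exact_mod_cast hd0
  set K : ℝ := 1 + C ^ 2 * (σ : ℝ) ^ 2
  set κ : ℝ := Var[fun x => x ^ 2; gaussianReal 0 1]
  have hκ : 0 ≤ κ := variance_nonneg _ _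
  have hK : 0 < K := by positivity
  refine ⟨Real.sqrt ((K ^ 2 * κ + 1) / d), by positivity, fun n hT => ?_⟩
  have hT' : (0 : ℝ) < T n := by exact_mod_cast hT
  refine ((hA.isWhiteNoise_predError (lam n) (J n)).measure_abs_sum_sq_sub_ge hT
    (by positivity)).trans (le_trans ?_ hd.le)
  rw [← ENNReal.ofReal_coe_nnreal]
  refine ENNReal.ofReal_le_ofReal ?_
  have h1 : condVar (J n) σ (lam n) ≤ K := (condVar_le _ _ _).trans (by
    have h2 := abs_le.1 (hC n 0 (Nat.zero_le _))
    have : lam n 0 ^ 2 ≤ C ^ 2 := sq_le_sq' h2.1 h2.2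
    simp only [K]
    gcongr)
  have h0 := one_le_condVar (J n) σ (lam n)
  rw [div_pow, Real.sq_sqrt hT'.le, Real.sq_sqrt (by positivity)]
  calc condVar (J n) σ (lam n) ^ 2 * κ / T n / ((K ^ 2 * κ + 1) / d / T n)
      = (d : ℝ) * (condVar (J n) σ (lam n) ^ 2 * κ / (K ^ 2 * κ + 1)) := by field_simp
    _ ≤ (d : ℝ) * 1 := by
      gcongr
      rw [div_le_one (by positivity)]
      have : condVar (J n) σ (lam n) ^ 2 * κ ≤ K ^ 2 * κ := by gcongr
      linarith
    _ = d := mul_one _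

/-- With probability close to one, the Gram matrix is well conditioned, the score is of order
`(J / T)^{1/2}` and the mean squared prediction error is within `O(T^{-1/2})` of its mean. -/
theorem exists_eventually_good [IsProbabilityMeasure μ] (hA : FactorAssumptions μ σ F ε)
    (hJ : Tendsto J atTop atTop) (hT : Tendsto T atTop atTop)
    (hlam : ∃ C : ℝ, ∀ n, ∀ i ≤ J n, |lam n i| ≤ C)
    (hD : ∀ᵐ ω ∂μ, 0 < liminf (fun n => gramMin (J n) (T n) (lam n) F ε ω) atTop)
    {δ : ℝ≥0∞} (hδ : 0 < δ) :
    ∃ c A B : ℝ, 0 < c ∧ 0 < A ∧ 0 < B ∧ ∀ᶠ n in atTop, μ {ω | ¬ (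
      (∀ u, c * ‖u‖ ^ 2 ≤
        designForm (T n) (fun t => donors (J n) (lam n) F ε t ω) u u) ∧
      |targetRisk (J n) (T n) σ (lam n) F ε ω - condVar (J n) σ (lam n)| ≤
        A / Real.sqrt (T n) ∧
      ‖score (J n) (T n) σ (lam n) F ε ω‖ ^ 2 ≤ B * ((J n : ℝ) / T n))} ≤ δ := by
  have hδ3 : 0 < δ / 3 := ENNReal.div_pos hδ.ne' (by simp)
  obtain ⟨c, hc, h1⟩ := hA.exists_eventually_le_designForm hD hδ3
  obtain ⟨A, hA0, h2⟩ := hA.exists_measure_targetRisk_le (T := T) hlam hδ3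
  obtain ⟨B, hB, h3⟩ := hA.exists_measure_score_le (T := T) hlam hδ3
  refine ⟨c, A, B, hc, hA0, hB, ?_⟩
  filter_upwards [h1, hJ.eventually_gt_atTop 0, hT.eventually_gt_atTop 0] with n hn hJn hTn
  refine (measure_mono fun ω hω => ?_).trans ((measure_union_le _ _).trans
    ((add_le_add ((measure_union_le _ _).trans (add_le_add hn (h2 n hTn)))
      (h3 n hJn hTn)).trans_eq (ENNReal.add_thirds δ)))
  by_contra hcon
  simp only [Set.mem_union, Set.mem_ofPred_eq, not_or, not_not, not_le, not_lt] at hcon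
  exact hω ⟨hcon.1.1, hcon.1.2.le, hcon.2⟩

/-- For every linear functional `a` the studentized sum of the prediction errors is exactly
standard normal, because its coefficients depend on the donors alone. -/
theorem hasLaw_student [IsProbabilityMeasure μ] (hA : FactorAssumptions μ σ F ε) (J : ℕ) {T : ℕ}
    (hT : 0 < T) (lam : ℕ → ℝ) (a : EuclideanSpace ℝ (Fin J)) :
    HasLaw (fun ω => (∑ t ∈ Finset.range T,
      studentCoef T a (fun t => donors J lam F ε t ω) t * predError J σ lam F ε t ω) /
        Real.sqrt (condVar J σ lam)) (gaussianReal 0 1) μ := by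
  have h := (hA.isWhiteNoise_predError lam J).hasLaw_sum_of_indepFun
    (hA.aemeasurable_donors lam J) (hA.indepFun_predError_donors lam J) (Finset.range T)
    (measurable_studentCoef T a) (fun y => sum_studentCoef_sq hT a)
  have hv : 0 < condVar J σ lam := zero_lt_one.trans_le (one_le_condVar J σ lam)
  convert gaussianReal_div_const h (Real.sqrt (condVar J σ lam)) using 1
  congr 1
  · simp
  · ext
    simp [Real.sq_sqrt hv.le, hv.le, hv.ne']

end FactorAssumptions

end Events

/-- Random variables that agree with standard normal ones outside events of vanishing probability
converge in distribution to `N(0, 1)`. -/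
theorem tendstoInDistribution_gaussianReal_of_eq [IsProbabilityMeasure μ] {X Z : ℕ → Ω → ℝ}
    (hX : ∀ n, AEMeasurable (X n) μ) (hZ : ∀ n, HasLaw (Z n) (gaussianReal 0 1) μ)
    (h : ∀ δ : ℝ≥0∞, 0 < δ → ∀ᶠ n in atTop, μ {ω | X n ω ≠ Z n ω} ≤ δ) :
    TendstoInDistribution X atTop (id : ℝ → ℝ) (fun _ => μ) (gaussianReal 0 1) := by
  have hid : HasLaw (id : ℝ → ℝ) (gaussianReal 0 1) (gaussianReal 0 1) := HasLaw.id
  have hZd : TendstoInDistribution Z atTop (id : ℝ → ℝ) (fun _ => μ) (gaussianReal 0 1) :=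
    tendstoInDistribution_of_identDistrib 0
      (fun j => ⟨(hZ 0).aemeasurable, (hZ j).aemeasurable, (hZ 0).map_eq.trans (hZ j).map_eq.symm⟩)
      ⟨(hZ 0).aemeasurable, hid.aemeasurable, (hZ 0).map_eq.trans hid.map_eq.symm⟩
  refine tendstoInDistribution_of_tendstoInMeasure_sub X id hZd ?_ hX
  intro η hη
  refine ENNReal.tendsto_nhds_zero.2 fun δ hδ => ?_
  filter_upwards [h δ hδ] with n hn
  refine (measure_mono fun ω hω hEq => ?_).trans hn
  simp only [Set.mem_ofPred_eq, Pi.sub_apply, hEq, sub_self, Pi.zero_apply, edist_self] at hω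
  exact absurd hω (not_le.2 hη)

theorem sigmaAlpha_eq [IsProbabilityMeasure μ] {σ : ℝ≥0} {F : ℕ → Ω → ℝ} {ε : ℕ → ℕ → Ω → ℝ}
    (hA : FactorAssumptions μ σ F ε) (J T : ℕ) (lam : ℕ → ℝ) (α : EuclideanSpace ℝ (Fin J))
    (ω : Ω) :
    sigmaAlpha μ J T σ lam F ε α ω = Real.sqrt (condVar J σ lam *
      inner ℝ α (designSolve T (fun t => donors J lam F ε t ω) α)) := by
  rw [sigmaAlpha, hA.errVar_eq, EuclideanSpace.inner_eq_star_dotProduct, dotProduct_comm]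
  rfl

end SynthControl

theorem theorem5 {Ω : Type*} [MeasurableSpace Ω] (μ : Measure Ω) [IsProbabilityMeasure μ]
    (σ : ℝ≥0) (F : ℕ → Ω → ℝ) (ε : ℕ → ℕ → Ω → ℝ)
    (hA : SynthControl.FactorAssumptions μ σ F ε)
    -- numbers of donors and of pre-treatment periods
    (J T : ℕ → ℕ) (hJ : Tendsto J atTop atTop) (hT : Tendsto T atTop atTop)
    -- uniformly bounded loadings, which may change with the sample
    (lam : ℕ → ℕ → ℝ) (hlam : ∃ C : ℝ, ∀ n, ∀ i ≤ J n, |lam n i| ≤ C)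
    -- compact parameter spaces containing the target parameter
    (Θ : ∀ n, Set (EuclideanSpace ℝ (Fin (J n)) × ℝ))
    (hΘ : ∀ n, IsCompact (Θ n)) (hΘpos : ∀ n, ∀ θ ∈ Θ n, 0 < θ.2)
    (hΘtarget : ∀ n, SynthControl.targetParam μ (J n) σ (lam n) F ε ∈ Θ n)
    -- the maximum likelihood estimators
    (θhat : ∀ n, Ω → EuclideanSpace ℝ (Fin (J n)) × ℝ)
    (hmeas : ∀ n, AEMeasurable (θhat n) μ)
    (hmle : ∀ n, ∀ᵐ ω ∂μ, θhat n ω ∈ Θ n ∧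
      IsMaxOn (SynthControl.logLik (J n) (T n) (lam n) F ε ω) (Θ n) (θhat n ω))
    -- eigenvalues of the Gram matrix bounded away from zero and infinity
    (hD : ∀ᵐ ω ∂μ,
      0 < liminf (fun n => SynthControl.gramMin (J n) (T n) (lam n) F ε ω) atTop ∧
      limsup (fun n => SynthControl.gramMax (J n) (T n) (lam n) F ε ω) atTop < ⊤)
    (hmax : SynthControl.IsBigOp μ
      (fun n => SynthControl.maxSqNorm (J n) (T n) (lam n) F ε) (fun n => (J n : ℝ)))
    (hfourth : SynthControl.IsBigOp μ
      (fun n => SynthControl.fourthMomentSup (J n) (T n) (lam n) F ε) (fun n => (T n : ℝ))) :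
    ((fun n => (J n : ℝ) * Real.log (J n) ^ 3) =o[atTop] (fun n => (T n : ℝ)) →
      SynthControl.IsBigOp μ
        (fun n ω => ‖(θhat n ω).1 - SynthControl.targetWeights (J n) σ (lam n)‖ ^ 2)
        (fun n => (J n : ℝ) / (T n : ℝ))) ∧
    ((fun n => (J n : ℝ) ^ 2 * Real.log (J n)) =o[atTop] (fun n => (T n : ℝ)) →
      -- the target parameter is an interior point, uniformly in `n`
      (∃ r : ℝ, 0 < r ∧ ∀ n,
        Metric.ball (SynthControl.targetParam μ (J n) σ (lam n) F ε) r ⊆ Θ n) →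
      ∀ α : ∀ n, EuclideanSpace ℝ (Fin (J n)), (∀ᶠ n in atTop, α n ≠ 0) →
        TendstoInDistribution
          (fun n ω => Real.sqrt (T n) *
            inner ℝ (α n) ((θhat n ω).1 - SynthControl.targetWeights (J n) σ (lam n)) /
              SynthControl.sigmaAlpha μ (J n) (T n) σ (lam n) F ε (α n) ω)
          atTop (id : ℝ → ℝ) (fun _ => μ) (gaussianReal 0 1)) := by
  have hD' : ∀ᵐ ω ∂μ,
      0 < liminf (fun n => SynthControl.gramMin (J n) (T n) (lam n) F ε ω) atTop :=
    hD.mono fun ω h => h.1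
  have htarget : ∀ n, SynthControl.targetParam μ (J n) σ (lam n) F ε =
      (SynthControl.targetWeights (J n) σ (lam n), SynthControl.condVar (J n) σ (lam n)) :=
    fun n => by rw [SynthControl.targetParam, hA.errVar_eq]
  simp only [htarget] at hΘtarget ⊢
  have hsqrt : ∀ A : ℝ, Tendsto (fun n => A / Real.sqrt (T n)) atTop (𝓝 0) := fun A =>
    tendsto_const_nhds.div_atTop
      (Real.tendsto_sqrt_atTop.comp (tendsto_natCast_atTop_atTop.comp hT))
  refine ⟨fun _ δ hδ => ?_, fun hJT ⟨r, hr, hball⟩ α hα => ?_⟩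
  · obtain ⟨c, A, B, hc, hA0, hB, hgood⟩ := hA.exists_eventually_good hJ hT hlam hD' hδ
    obtain ⟨C, hC⟩ := hlam
    set K : ℝ := 1 + C ^ 2 * (σ : ℝ) ^ 2
    refine ⟨4 / c ^ 2 * B + 4 / c * (K * Real.exp (3 / 2) * A ^ 2), ?_⟩
    filter_upwards [hgood, hJ.eventually_ge_atTop 1, hT.eventually_gt_atTop 0,
      (hsqrt A).eventually_le_const (show (0 : ℝ) < 1 / 2 by norm_num)] with n hn hJn hTn hAn
    refine (measure_mono_ae ?_).trans hn
    filter_upwards [hmle n] with ω hω hlt hg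
    obtain ⟨hq, hs, hb⟩ := hg
    have hle := SynthControl.norm_sq_le_of_isMaxOn hc hq (hΘpos n) (hΘtarget n) hω.1 hω.2
      (SynthControl.one_le_condVar _ _ _) hs hAn
    have hTn' : (0 : ℝ) < T n := by exact_mod_cast hTn
    have hJn' : (1 : ℝ) ≤ J n := by exact_mod_cast hJn
    have hK : SynthControl.condVar (J n) σ (lam n) ≤ K :=
      (SynthControl.condVar_le _ _ _).trans (by
        have h2 := abs_le.1 (hC n 0 (Nat.zero_le _))
        have : lam n 0 ^ 2 ≤ C ^ 2 := sq_le_sq' h2.1 h2.2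
        simp only [K]
        gcongr)
    have hA2 : (A / Real.sqrt (T n)) ^ 2 ≤ A ^ 2 * ((J n : ℝ) / T n) := by
      rw [div_pow, Real.sq_sqrt hTn'.le, ← mul_div_assoc]
      gcongr
      exact le_mul_of_one_le_right (by positivity) hJn'
    refine absurd hlt (not_lt.2 ((abs_of_nonneg (sq_nonneg _)).trans_le (hle.trans ?_)))
    calc _ ≤ 4 / c ^ 2 * (B * ((J n : ℝ) / T n)) +
          4 / c * (K * Real.exp (3 / 2) * (A ^ 2 * ((J n : ℝ) / T n))) := by
          have := zero_le_one.trans (SynthControl.one_le_condVar (J n) σ (lam n))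
          gcongr
      _ = _ := by ring
  · have hratio : Tendsto (fun n => (J n : ℝ) / T n) atTop (𝓝 0) := by
      refine IsLittleO.tendsto_div_nhds_zero (IsBigO.trans_isLittleO (IsBigO.of_bound 1 ?_) hJT)
      filter_upwards [hJ.eventually_ge_atTop 3] with n hn
      have hn' : (3 : ℝ) ≤ J n := by exact_mod_cast hn
      have hlog : 1 ≤ Real.log (J n) := by
        rw [Real.le_log_iff_exp_le (by linarith)]
        exact Real.exp_one_lt_d9.le.trans (by norm_num; linarith)
      rw [Real.norm_of_nonneg (by positivity), Real.norm_of_nonneg (by positivity), one_mul]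
      nlinarith [sq_nonneg (J n : ℝ)]
    -- The formula for `Z` needs at least one period; finitely many `n` do not matter.
    -- The formula for `Z` needs at least one period; finitely many `n` do not matter.
    choose Z hZ using fun n => show ∃ Z : Ω → ℝ, HasLaw Z (gaussianReal 0 1) μ ∧
        (0 < T n → Z = fun ω => (∑ t ∈ Finset.range (T n), SynthControl.studentCoef (T n) (α n)
          (fun t => SynthControl.donors (J n) (lam n) F ε t ω) t *
            SynthControl.predError (J n) σ (lam n) F ε t ω) /
              Real.sqrt (SynthControl.condVar (J n) σ (lam n))) by
      by_cases h : 0 < T n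
      · exact ⟨_, hA.hasLaw_student (J n) h (lam n) (α n), fun _ => rfl⟩
      · exact ⟨ε 0 0, hA.law_ε 0 0, fun h' => absurd h' h⟩
    have hX : ∀ n, AEMeasurable (fun ω => Real.sqrt (T n) *
        inner ℝ (α n) ((θhat n ω).1 - SynthControl.targetWeights (J n) σ (lam n)) /
          SynthControl.sigmaAlpha μ (J n) (T n) σ (lam n) F ε (α n) ω) μ := by
      intro n
      simp only [SynthControl.sigmaAlpha_eq hA]
      have h1 := (SynthControl.measurable_designSolve (T n) (α n)).comp_aemeasurable
        (hA.aemeasurable_donors (lam n) (J n))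
      exact ((AEMeasurable.inner aemeasurable_const
        ((measurable_fst.comp_aemeasurable (hmeas n)).sub_const _)).const_mul _).div
        ((AEMeasurable.inner aemeasurable_const h1).const_mul _).sqrt
    refine SynthControl.tendstoInDistribution_gaussianReal_of_eq hX (fun n => (hZ n).1)
      fun δ hδ => ?_
    obtain ⟨c, A, B, hc, hA0, hB, hgood⟩ := hA.exists_eventually_good hJ hT hlam hD' hδ
    have hlim1 : Tendsto (fun n => Real.sqrt (B * ((J n : ℝ) / T n)) / c) atTop (𝓝 0) := by
      simpa using ((hratio.const_mul B).sqrt).div_const c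
    have hlim2 : Tendsto (fun n => A / Real.sqrt (T n) + B * ((J n : ℝ) / T n) / c) atTop
        (𝓝 0) := by
      simpa using (hsqrt A).add ((hratio.const_mul B).div_const c)
    filter_upwards [hgood, hT.eventually_gt_atTop 0, hα, hlim1.eventually_lt_const hr,
      hlim2.eventually_lt_const hr] with n hn hTn hαn h1 h2
    refine (measure_mono_ae ?_).trans hn
    filter_upwards [hmle n] with ω hω hne hg
    obtain ⟨hq, hs, hb⟩ := hg
    refine hne ?_
    have heq := SynthControl.eq_designSolve_of_isMaxOn hc hq (hΘpos n) (hball n) hω.1 hω.2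
      (lt_of_le_of_lt (by gcongr; exact Real.le_sqrt_of_sq_le hb) h1)
      (lt_of_le_of_lt (by gcongr) h2)
    rw [(hZ n).2 hTn, heq, SynthControl.sigmaAlpha_eq hA,
      SynthControl.student_eq_sum (zero_lt_one.trans_le (SynthControl.one_le_condVar _ _ _))
        hc hq hTn hαn]
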